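/- Let $V=\bigoplus_{n\ge 1}V^n$ be a graded rational vector space, let $\Lambda V=\mathrm{Sym}(V^{\mathrm{even}})\otimes \mathrm{Ext}(V^{\mathrm{odd}})$ be the free graded commutative algebra on $V$, and write $\Lambda^kV$ for its subspace spanned by products of $k$ elements of $V$. Let $(\Lambda V,d)$ be a minimal Sullivan algebra: $d$ is a derivation of degree $+1$ with $d^2=0$ and $d(V)\subseteq\Lambda^{\ge 2}V$, and $V$ is the union of an increasing sequence of graded subspaces $V(0)\subseteq V(1)\subseteq\cdots$ such that $d=0$ on $V(0)$ and $d(V(k+1))\subseteq\Lambda V(k)$ for all $k\ge 0$. Suppose that $(\Lambda V,d)$ is elliptic, i.e. $\dim V<\infty$ and $\dim H^*(\Lambda V,d)<\infty$, and coformal, i.e. $d$ is homogeneous of length two: $d(V)\subseteq \Lambda^2V$. Then Hilali's conjecture holds for $(\Lambda V,d)$: $$\dim H^*(\Lambda V,d)\ \ge\ \dim V .$$ -/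

import Mathlib

open scoped DirectSum TensorProduct

noncomputable section

universe u

namespace RationalHomotopy

variable (V : ℕ → Type u) [∀ n, AddCommGroup (V n)] [∀ n, Module ℚ (V n)]

/-- The even part of the graded rational vector space `V = ⨁ n, V n`. -/
abbrev EvenPart : Type u := ⨁ n : {n : ℕ // Even n}, V n

/-- The odd part of the graded rational vector space `V = ⨁ n, V n`. -/
abbrev OddPart : Type u := ⨁ n : {n : ℕ // Odd n}, V n

/-- The free graded commutative algebra `ΛV = Sym(V^even) ⊗ Ext(V^odd)`. Elements of `V^even` have
even degree, so the graded and the ordinary multiplication on this tensor product coincide. -/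
def FreeCGA : Type u :=
  SymmetricAlgebra ℚ (EvenPart V) ⊗[ℚ] ExteriorAlgebra ℚ (OddPart V)

instance : Ring (FreeCGA V) :=
  inferInstanceAs (Ring (SymmetricAlgebra ℚ (EvenPart V) ⊗[ℚ] ExteriorAlgebra ℚ (OddPart V)))

instance : Algebra ℚ (FreeCGA V) :=
  inferInstanceAs (Algebra ℚ (SymmetricAlgebra ℚ (EvenPart V) ⊗[ℚ] ExteriorAlgebra ℚ (OddPart V)))

/-- The inclusion `Sym(V^even) → ΛV`, `a ↦ a ⊗ 1`. -/
def inclSym : SymmetricAlgebra ℚ (EvenPart V) →ₐ[ℚ] FreeCGA V :=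
  (Algebra.TensorProduct.includeLeft : SymmetricAlgebra ℚ (EvenPart V) →ₐ[ℚ]
    SymmetricAlgebra ℚ (EvenPart V) ⊗[ℚ] ExteriorAlgebra ℚ (OddPart V))

/-- The inclusion `Ext(V^odd) → ΛV`, `b ↦ 1 ⊗ b`. -/
def inclExt : ExteriorAlgebra ℚ (OddPart V) →ₐ[ℚ] FreeCGA V :=
  (Algebra.TensorProduct.includeRight : ExteriorAlgebra ℚ (OddPart V) →ₐ[ℚ]
    SymmetricAlgebra ℚ (EvenPart V) ⊗[ℚ] ExteriorAlgebra ℚ (OddPart V))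

variable {V}

/-- The inclusion `V n → ΛV` of the generators of degree `n`. -/
def gen (n : ℕ) : V n →ₗ[ℚ] FreeCGA V :=
  if h : Even n then
    (inclSym V).toLinearMap ∘ₗ SymmetricAlgebra.ι ℚ (EvenPart V) ∘ₗ
      DirectSum.lof ℚ {n : ℕ // Even n} (fun i => V i) ⟨n, h⟩
  else
    (inclExt V).toLinearMap ∘ₗ ExteriorAlgebra.ι ℚ (M := OddPart V) ∘ₗ
      DirectSum.lof ℚ {n : ℕ // Odd n} (fun i => V i) ⟨n, Nat.not_even_iff_odd.mp h⟩

/-- The product in `ΛV` of a list of homogeneous elements of `V`. -/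
def monomial (l : List (Σ n, V n)) : FreeCGA V :=
  (l.map fun p => gen p.1 p.2).prod

variable (V)

/-- `(ΛV)^n`: the elements of degree `n`, spanned by the products `v₁ ⋯ vₖ` of homogeneous
elements of `V` whose degrees add up to `n`. -/
def degreePart (n : ℕ) : Submodule ℚ (FreeCGA V) :=
  Submodule.span ℚ {x | ∃ l : List (Σ n, V n), (l.map Sigma.fst).sum = n ∧ monomial l = x}

/-- `Λ^k V`: the elements of word length `k`, spanned by the products of `k` elements of `V`. -/
def wordLengthPart (k : ℕ) : Submodule ℚ (FreeCGA V) :=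
  Submodule.span ℚ {x | ∃ l : List (Σ n, V n), l.length = k ∧ monomial l = x}

variable {V}

/-- The subalgebra `ΛU ⊆ ΛV` generated by a graded subspace `U ⊆ V`. -/
def subFreeCGA (U : ∀ n, Submodule ℚ (V n)) : Subalgebra ℚ (FreeCGA V) :=
  Algebra.adjoin ℚ {x | ∃ (n : ℕ) (v : V n), v ∈ U n ∧ gen n v = x}

variable (V)

/-- A minimal Sullivan algebra `(ΛV, d)` over `ℚ`, with `V` concentrated in positive degrees. -/
structure MinimalSullivanAlgebra where
  /-- `V` is concentrated in positive degrees. -/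
  degree_pos : Subsingleton (V 0)
  /-- The differential. -/
  d : FreeCGA V →ₗ[ℚ] FreeCGA V
  /-- The differential has degree `+1`. -/
  d_degree : ∀ (n : ℕ) (a : FreeCGA V), a ∈ degreePart V n → d a ∈ degreePart V (n + 1)
  /-- The differential squares to zero. -/
  d_d : ∀ a : FreeCGA V, d (d a) = 0
  /-- The differential is a graded derivation. -/
  leibniz : ∀ (n : ℕ) (a b : FreeCGA V), a ∈ degreePart V n →
    d (a * b) = d a * b + (-1 : ℚ) ^ n • (a * d b)
  /-- The Sullivan (nilpotence) condition: `V` is the union of graded subspaces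
  `F 0 ⊆ F 1 ⊆ ⋯` with `d (F 0) = 0` and `d (F (k + 1)) ⊆ Λ (F k)`. -/
  nilpotence : ∃ F : ℕ → ∀ n, Submodule ℚ (V n), Monotone F ∧
    (∀ (n : ℕ) (v : V n), ∃ k, v ∈ F k n) ∧
    (∀ (n : ℕ) (v : V n), v ∈ F 0 n → d (gen n v) = 0) ∧
    (∀ (k n : ℕ) (v : V n), v ∈ F (k + 1) n → d (gen n v) ∈ subFreeCGA (F k))
  /-- Minimality: `d V ⊆ Λ^{≥ 2} V`. -/
  minimal : ∀ (n : ℕ) (v : V n), d (gen n v) ∈ ⨆ k ≥ 2, wordLengthPart V k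

namespace MinimalSullivanAlgebra

variable {V}

/-- The (total) cohomology `H^*(ΛV, d) = ker d / im d`. -/
abbrev Cohomology (A : MinimalSullivanAlgebra V) : Type u :=
  LinearMap.ker A.d ⧸ (LinearMap.range A.d).submoduleOf (LinearMap.ker A.d)

/-- `(ΛV, d)` is elliptic: both `V` and `H^*(ΛV, d)` are finite-dimensional. -/
def IsElliptic (A : MinimalSullivanAlgebra V) : Prop :=
  Module.Finite ℚ (⨁ n, V n) ∧ Module.Finite ℚ A.Cohomology

/-- `(ΛV, d)` is coformal: the differential is homogeneous of length two, `d V ⊆ Λ² V`. -/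
def IsCoformal (A : MinimalSullivanAlgebra V) : Prop :=
  ∀ (n : ℕ) (v : V n), A.d (gen n v) ∈ wordLengthPart V 2

end MinimalSullivanAlgebra

end RationalHomotopy

end

/-! Give a monomial the weight "degree minus word length". A quadratic differential of degree one
preserves this weight and raises the word length by one, so `ΛV` splits into one complex for each
weight `m`. Even generators have odd, hence positive, weight `a`; odd generators have even weight
`c` and square to zero, so each of these complexes is finite-dimensional. Let `p` be the number of
even generators, `r` that of generators of degree one (where `c = 0`) and `q` that of the other odd
generators.

The product of the degree-one generators generates an ideal that is a subcomplex. Its Euler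
characteristics, as coefficients of a series in the weight, form `P = ± ∏ (1 - t^c) / ∏ (1 + t^a)`,
the upper product running over `c ≠ 0`; in `ΛV` itself each degree-one generator would contribute a
factor `1 - t^0 = 0`. Removing these generators from the ideal one at a time by a Gysin argument
(`gysin_nonexact`) turns one class of weight `m` in the ideal into nonzero cohomology of `ΛV` in `r
+ 1` consecutive word lengths (`nonexact_of_lower`). Finite cohomology thus makes `P` a polynomial.
It is divisible by `(t - 1)^q`, and comparing zeros at `-1` gives `p ≤ q`
(`exists_polynomial_of_signedCount`).

Such a `P` has more than `q` nonzero coefficients, whence `dim H ≥ (q + 1)(r + 1)`; for `r ≥ 1` this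
is at least `2q + r ≥ p + q + r`. For `r = 0` the absolute values of the coefficients sum to at most
`dim H`, and to at least `2q ≥ p + q` by Newton's identities (`two_mul_le_sum_abs_coeff`). -/

open Module

/-! ### Coefficients of polynomials that vanish to high order at 1 -/

namespace Polynomial

/-- The operator `X * derivative` multiplies the `m`-th coefficient by `m` and costs at most one
order of vanishing at 1, so each moment reduces to the value at 1. -/
theorem sum_coeff_mul_pow_eq_zero {R : Type*} [CommRing R] (i : ℕ) :
    ∀ {q : ℕ} {P : R[X]}, (X - 1) ^ q ∣ P → i < q →
      ∑ m ∈ P.support, P.coeff m * (m : R) ^ i = 0 := by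
  induction i with
  | zero =>
    intro q P h hq
    have h1 : (X - 1) ∣ P := (dvd_pow_self _ hq.ne').trans h
    obtain ⟨Q, rfl⟩ := h1
    have : eval 1 ((X - 1) * Q) = 0 := by simp
    rw [eval_eq_sum, sum_def] at this
    simpa using this
  | succ i ih =>
    intro q P h hq
    obtain ⟨q, rfl⟩ : ∃ q', q = q' + 1 := ⟨q - 1, by omega⟩
    have h1 : (X - 1) ^ q ∣ X * derivative P := by
      obtain ⟨Q, rfl⟩ := h
      refine Dvd.dvd.mul_left ?_ _
      rw [derivative_mul, derivative_pow]
      simp only [derivative_sub, derivative_X, derivative_one, sub_zero, mul_one, add_tsub_cancel_right]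
      exact dvd_add (Dvd.dvd.mul_right (Dvd.intro_left _ rfl) _)
        (Dvd.dvd.mul_right (pow_dvd_pow _ (Nat.le_succ q)) _)
    have h2 := ih h1 (by omega)
    have hc : ∀ m, (X * derivative P).coeff m = P.coeff m * m := by
      intro m
      cases m with
      | zero => simp
      | succ m => simp [coeff_X_mul, coeff_derivative]
    rw [← h2]
    symm
    rw [Finset.sum_subset (s₂ := P.support)]
    · refine Finset.sum_congr rfl fun m _ => ?_
      rw [hc, pow_succ]; ring
    · intro m hm
      rw [mem_support_iff, hc] at hm
      rw [mem_support_iff]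
      intro h0; simp [h0] at hm
    · intro m _ hm
      rw [notMem_support_iff.mp hm, zero_mul]

theorem sum_coeff_mul_eval_eq_zero {R : Type*} [CommRing R] {q : ℕ} {P : R[X]}
    (h : (X - 1) ^ q ∣ P) (g : R[X]) (hg : g.natDegree < q) :
    ∑ m ∈ P.support, P.coeff m * g.eval (m : R) = 0 := by
  simp_rw [eval_eq_sum_range, Finset.mul_sum]
  rw [Finset.sum_comm]
  refine Finset.sum_eq_zero fun i hi => ?_
  rw [Finset.mem_range] at hi
  have := sum_coeff_mul_pow_eq_zero i h (by omega)
  simp_rw [mul_left_comm _ (g.coeff i), ← Finset.mul_sum, this, mul_zero]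

/-- With at most `q` exponents, a test polynomial of degree below `q` can vanish at all of them but
one, and the moment relation then isolates a single nonzero coefficient. -/
theorem lt_card_support_of_pow_dvd {q : ℕ} {P : ℤ[X]} (hP : P ≠ 0) (h : (X - 1) ^ q ∣ P) :
    q < P.support.card := by
  by_contra! hq
  obtain ⟨m₀, hm₀⟩ := nonempty_support_iff.mpr hP
  have h1 := sum_coeff_mul_eval_eq_zero h (∏ m ∈ P.support.erase m₀, (X - C (m : ℤ))) (by
    rw [natDegree_prod_of_monic _ _ fun m _ => monic_X_sub_C _]
    simp only [natDegree_X_sub_C, Finset.sum_const, smul_eq_mul, mul_one]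
    exact (Finset.card_erase_lt_of_mem hm₀).trans_le hq)
  rw [Finset.sum_eq_single_of_mem m₀ hm₀] at h1
  · rw [eval_prod, mul_eq_zero] at h1
    rcases h1 with h1 | h1
    · exact mem_support_iff.mp hm₀ h1
    · rw [Finset.prod_eq_zero_iff] at h1
      obtain ⟨m, hm, h1⟩ := h1
      simp only [eval_sub, eval_X, eval_C, sub_eq_zero, Nat.cast_inj] at h1
      exact (Finset.mem_erase.mp hm).1 h1.symm
  · intro m hm hne
    rw [eval_prod, Finset.prod_eq_zero (i := m) (Finset.mem_erase.mpr ⟨hne, hm⟩) (by simp), mul_zero]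

end Polynomial

/-- Newton's identities express `k * esymm k` through power sums and earlier `esymm`; characteristic
zero permits division by `k`. -/
theorem MvPolynomial.aeval_esymm_eq_of_aeval_psum_eq {σ K : Type*} [Fintype σ] [Field K] [CharZero K]
    (f g : σ → K) (n : ℕ) (h : ∀ i, 0 < i → i ≤ n → ∑ j, f j ^ i = ∑ j, g j ^ i) :
    ∀ k ≤ n, aeval f (esymm σ K k) = aeval g (esymm σ K k) := by
  classical
  intro k
  induction k using Nat.strong_induction_on with
  | _ k ih =>
    intro hk
    rcases Nat.eq_zero_or_pos k with rfl | hk0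
    · simp
    have hp : ∀ i, 0 < i → i ≤ n → aeval f (psum σ K i) = aeval g (psum σ K i) := by
      intro i hi hin
      simpa [psum] using h i hi hin
    have hk' : (k : K) ≠ 0 := by exact_mod_cast hk0.ne'
    apply mul_left_cancel₀ hk'
    have hN := mul_esymm_eq_sum σ K k
    have h1 := congrArg (aeval f) hN
    have h2 := congrArg (aeval g) hN
    simp only [map_mul, map_natCast] at h1 h2
    rw [h1, h2]
    have h3 : aeval f ((-1 : MvPolynomial σ K) ^ (k + 1)) = aeval g ((-1 : MvPolynomial σ K) ^ (k + 1)) := by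
      simp
    rw [h3, map_sum, map_sum]
    congr 1
    refine Finset.sum_congr rfl fun a ha => ?_
    obtain ⟨ha', ha⟩ := Finset.mem_filter.mp ha
    rw [Finset.HasAntidiagonal.mem_antidiagonal] at ha'
    rw [map_mul, map_mul, map_mul, map_mul, ih a.1 ha (by omega), hp a.2 (by omega) (by omega)]
    simp

theorem Multiset.eq_of_sum_pow_eq {K : Type*} [Field K] [CharZero K] (s t : Multiset K)
    (h : ∀ i ≤ s.card, (s.map (· ^ i)).sum = (t.map (· ^ i)).sum) : s = t := by
  classical
  have hc : s.card = t.card := by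
    have := h 0 (Nat.zero_le _)
    simpa using this
  have hex : ∀ (n : ℕ) (u : Multiset K), u.card = n →
      ∃ f : Fin n → K, Finset.univ.val.map f = u := by
    intro n u hu
    obtain ⟨l, rfl⟩ : ∃ l : List K, (l : Multiset K) = u := Quot.exists_rep u
    obtain rfl : l.length = n := by simpa using hu
    exact ⟨l.get, by rw [Fin.univ_val_map, List.ofFn_get]⟩
  obtain ⟨f, hf⟩ := hex _ s rfl
  obtain ⟨g, hg⟩ := hex _ t hc.symm
  have key := MvPolynomial.aeval_esymm_eq_of_aeval_psum_eq f g s.card fun i _ hi => by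
    have := h i hi
    rw [← hf, ← hg, Multiset.map_map, Multiset.map_map] at this
    exact this
  simp only [MvPolynomial.aeval_esymm_eq_multiset_esymm, hf, hg] at key
  have hp : (s.map fun a => Polynomial.X - Polynomial.C a).prod =
      (t.map fun a => Polynomial.X - Polynomial.C a).prod := by
    rw [Multiset.prod_X_sub_X_eq_sum_esymm, Multiset.prod_X_sub_X_eq_sum_esymm, ← hc]
    refine Finset.sum_congr rfl fun j hj => ?_
    rw [key j (by rw [Finset.mem_range] at hj; omega)]
  rw [← Polynomial.roots_multiset_prod_X_sub_C s, hp, Polynomial.roots_multiset_prod_X_sub_C]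

namespace Polynomial

/-- A Prouhet–Tarry–Escott argument: the exponents with positive and those with negative
coefficient, taken with multiplicity, have equal power sums of all orders below `q`. Multisets of
fewer than `q` elements would then coincide, yet these two are disjoint. -/
theorem two_mul_le_sum_abs_coeff {q : ℕ} {P : ℤ[X]} (hP : P ≠ 0)
    (h : (X - 1) ^ q ∣ P) : (2 * q : ℤ) ≤ ∑ m ∈ P.support, |P.coeff m| := by
  classical
  rcases Nat.eq_zero_or_pos q with rfl | hq
  · simpa using Finset.sum_nonneg fun m _ => abs_nonneg (P.coeff m)
  let S : (ℕ → ℕ) → Multiset ℚ := fun c =>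
    ∑ m ∈ P.support, Multiset.replicate (c m) (m : ℚ)
  have hS : ∀ c i, ((S c).map (· ^ i)).sum = ∑ m ∈ P.support, (c m : ℚ) * (m : ℚ) ^ i := by
    intro c i
    simp only [S]
    rw [← Multiset.coe_mapAddMonoidHom, map_sum, ← Multiset.coe_sumAddMonoidHom, map_sum]
    simp
  have hcard : ∀ c, (S c).card = ∑ m ∈ P.support, c m := by
    intro c
    simp [S]
  have hcount : ∀ c, ∀ m ∈ P.support, (S c).count (m : ℚ) = c m := by
    intro c m hm
    simp only [S, Multiset.count_sum', Multiset.count_replicate]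
    rw [Finset.sum_eq_single_of_mem m hm]
    · simp
    · intro b _ hb
      simp [hb]
  have hmom : ∀ i < q, ((S fun m => (P.coeff m).toNat).map (· ^ i)).sum =
      ((S fun m => (-P.coeff m).toNat).map (· ^ i)).sum := by
    intro i hi
    have h1 := sum_coeff_mul_pow_eq_zero i h hi
    rw [hS, hS, ← sub_eq_zero, ← Finset.sum_sub_distrib]
    have h2 : ((∑ m ∈ P.support, P.coeff m * (m : ℤ) ^ i : ℤ) : ℚ) = 0 := by rw [h1]; simp
    rw [← h2, Int.cast_sum]
    refine Finset.sum_congr rfl fun m _ => ?_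
    rw [← sub_mul]
    push_cast
    congr 1
    have h3 : ((P.coeff m).toNat : ℤ) - ((-P.coeff m).toNat : ℤ) = P.coeff m := by omega
    exact_mod_cast h3
  by_contra! hlt
  have hsum : ((∑ m ∈ P.support, (P.coeff m).toNat : ℕ) : ℤ) +
      ((∑ m ∈ P.support, (-P.coeff m).toNat : ℕ) : ℤ) = ∑ m ∈ P.support, |P.coeff m| := by
    push_cast
    rw [← Finset.sum_add_distrib]
    refine Finset.sum_congr rfl fun m _ => ?_
    rcases abs_cases (P.coeff m) with h | h <;> omega
  have hcc := hmom 0 hq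
  simp only [pow_zero, Multiset.map_const', Multiset.sum_replicate, nsmul_eq_mul, mul_one,
    Nat.cast_inj] at hcc
  rw [hcard, hcard] at hcc
  -- The two sizes are equal and add up to less than `2 * q`, so each is below `q`.
  have heq := Multiset.eq_of_sum_pow_eq _ _ fun i hi => hmom i (by
    rw [hcard] at hi
    omega)
  obtain ⟨m, hm⟩ := nonempty_support_iff.mpr hP
  have h1 := hcount (fun m => (P.coeff m).toNat) m hm
  rw [heq, hcount _ m hm] at h1
  exact mem_support_iff.mp hm (by omega)

end Polynomial

/-! ### The generating function of the signed count of monomials -/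

/-- The number of `α` with `∑ i, α i * a i = n`, counted with the sign `(-1) ^ (∑ i, α i)`, as
a power series in `n`. -/
theorem PowerSeries.prod_geom {ι : Type*} [Fintype ι] (a : ι → ℕ) (ha : ∀ i, 0 < a i) (n : ℕ)
    (s : Finset (ι →₀ ℕ)) (hs : ∀ α, α ∈ s ↔ ∑ i, α i * a i = n) :
    PowerSeries.coeff n (∏ i, PowerSeries.mk fun k => if a i ∣ k then (-1 : ℤ) ^ (k / a i) else 0) =
      ∑ α ∈ s, (-1 : ℤ) ^ ∑ i, α i := by
  classical
  rw [PowerSeries.coeff_prod]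
  symm
  refine Finset.sum_bij_ne_zero (fun α _ _ => Finsupp.equivFunOnFinite.symm fun i => α i * a i)
    ?_ ?_ ?_ ?_
  · intro α hα _
    rw [Finset.mem_finsuppAntidiag]
    exact ⟨(hs α).mp hα, Finset.subset_univ _⟩
  · intro α _ _ β _ _ h
    ext i
    have := DFunLike.congr_fun h i
    exact Nat.eq_of_mul_eq_mul_right (ha i) this
  · intro l hl hne
    have hd : ∀ i, a i ∣ l i := by
      intro i
      by_contra h
      exact hne (Finset.prod_eq_zero (Finset.mem_univ i) (by simp [h]))
    refine ⟨Finsupp.equivFunOnFinite.symm fun i => l i / a i, ?_, ?_, ?_⟩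
    · rw [hs]
      rw [← (Finset.mem_finsuppAntidiag.mp hl).1]
      exact Finset.sum_congr rfl fun i _ => Nat.div_mul_cancel (hd i)
    · exact pow_ne_zero _ (by norm_num)
    · ext i
      exact Nat.div_mul_cancel (hd i)
  · intro α hα _
    rw [← Finset.prod_pow_eq_pow_sum]
    refine Finset.prod_congr rfl fun i _ => ?_
    simp [Nat.mul_div_cancel _ (ha i)]

theorem PowerSeries.geom_mul_one_add {a : ℕ} (ha : 0 < a) :
    (PowerSeries.mk fun k => if a ∣ k then (-1 : ℤ) ^ (k / a) else 0) *
      (1 + PowerSeries.X ^ a) = 1 := by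
  ext n
  rw [mul_add, mul_one, map_add, PowerSeries.coeff_mul_X_pow', PowerSeries.coeff_mk,
    PowerSeries.coeff_one]
  by_cases h1 : a ∣ n
  · obtain ⟨c, rfl⟩ := h1
    cases c with
    | zero => simp [ha.ne']
    | succ c =>
      have h2 : a * (c + 1) - a = a * c := by rw [mul_add, mul_one, Nat.add_sub_cancel]
      rw [if_pos (dvd_mul_right _ _), if_pos (Nat.le_mul_of_pos_right _ (Nat.succ_pos c)), h2,
        PowerSeries.coeff_mk, if_pos (dvd_mul_right _ _), Nat.mul_div_cancel_left _ ha,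
        Nat.mul_div_cancel_left _ ha, if_neg (by positivity), pow_succ]
      ring
  · rw [if_neg h1, if_neg (fun h : n = 0 => h1 (h ▸ dvd_zero a)), zero_add]
    split_ifs with h2
    · rw [PowerSeries.coeff_mk, if_neg]
      intro h3
      have h4 := Nat.dvd_add h3 (dvd_refl a)
      rw [Nat.sub_add_cancel h2] at h4
      exact h1 h4
    · rfl

section SignedCount

variable {Ie Io : Type*} [Fintype Ie] [Fintype Io] [DecidableEq Io]

/-- Expanding the odd product over subsets picks the exterior part of the monomial; for `j ∈ T` the
summand `1` is replaced by `0`, which forces `j` to be picked. -/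
theorem PowerSeries.coeff_prod_geom_mul_prod (a : Ie → ℕ) (ha : ∀ i, 0 < a i) (c : Io → ℕ)
    (T : Finset Io) (n : ℕ) (s : Finset ((Ie →₀ ℕ) × Finset Io))
    (hs : ∀ b, b ∈ s ↔ T ⊆ b.2 ∧ ∑ i, b.1 i * a i + ∑ j ∈ b.2, c j = n) :
    PowerSeries.coeff n
      ((∏ i, PowerSeries.mk fun k => if a i ∣ k then (-1 : ℤ) ^ (k / a i) else 0) *
        ∏ j, (-PowerSeries.X ^ c j + if j ∈ T then 0 else 1)) =
      ∑ b ∈ s, (-1 : ℤ) ^ (∑ i, b.1 i + b.2.card) := by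
  classical
  rw [Finset.prod_add, Finset.powerset_univ, Finset.mul_sum, map_sum,
    ← Finset.sum_fiberwise s Prod.snd]
  refine Finset.sum_congr rfl fun S _ => ?_
  have h1 : ∏ j ∈ S, (-PowerSeries.X ^ c j : PowerSeries ℤ) =
      PowerSeries.C ((-1) ^ S.card) * PowerSeries.X ^ ∑ j ∈ S, c j := by
    rw [Finset.prod_neg, Finset.prod_pow_eq_pow_sum]
    simp
  have h2 : ∏ j ∈ Finset.univ \ S, (if j ∈ T then (0 : PowerSeries ℤ) else 1) =
      PowerSeries.C (if T ⊆ S then 1 else 0) := by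
    split_ifs with h
    · rw [map_one]
      refine Finset.prod_eq_one fun j hj => if_neg fun hjT => ?_
      exact (Finset.mem_sdiff.mp hj).2 (h hjT)
    · obtain ⟨j, hjT, hjS⟩ := Finset.not_subset.mp h
      rw [map_zero]
      exact Finset.prod_eq_zero (i := j) (by simp [hjS]) (if_pos hjT)
  rw [h1, h2, mul_assoc, mul_left_comm, PowerSeries.coeff_C_mul, mul_comm (PowerSeries.X ^ _),
    mul_left_comm, PowerSeries.coeff_C_mul, PowerSeries.coeff_mul_X_pow']
  by_cases hT : T ⊆ S
  · rw [if_pos hT, one_mul]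
    split_ifs with hn
    · rw [PowerSeries.prod_geom a ha (n - ∑ j ∈ S, c j) ((s.filter (·.2 = S)).image Prod.fst),
        Finset.sum_image, Finset.mul_sum]
      · refine Finset.sum_congr rfl fun b hb => ?_
        rw [(Finset.mem_filter.mp hb).2, pow_add, mul_comm]
      · intro b hb b' hb' h
        exact Prod.ext h ((Finset.mem_filter.mp hb).2.trans (Finset.mem_filter.mp hb').2.symm)
      · intro α
        simp only [Finset.mem_image, Finset.mem_filter, hs]
        constructor
        · rintro ⟨b, ⟨⟨_, h⟩, rfl⟩, rfl⟩
          omega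
        · intro h
          exact ⟨(α, S), ⟨⟨hT, by dsimp only; omega⟩, rfl⟩, rfl⟩
    · rw [mul_zero, Finset.sum_eq_zero]
      intro b hb
      obtain ⟨hbs, rfl⟩ := Finset.mem_filter.mp hb
      have := ((hs b).mp hbs).2
      omega
  · rw [if_neg hT, zero_mul, mul_zero, Finset.sum_eq_zero]
    intro b hb
    obtain ⟨hbs, rfl⟩ := Finset.mem_filter.mp hb
    exact absurd ((hs b).mp hbs).1 hT

open Polynomial in
/-- If the signed count of the exponents `(α, S)` of weight `n` vanishes for large `n`, then the
resulting polynomial vanishes at `1` to the order of the number of odd generators of positive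
weight, and there are at least as many of these as there are even generators. -/
theorem exists_polynomial_of_signedCount (a : Ie → ℕ) (ha : ∀ i, Odd (a i)) (c : Io → ℕ)
    (hc : ∀ j, Even (c j)) (s : ℕ → Finset ((Ie →₀ ℕ) × Finset Io))
    (hs : ∀ n b, b ∈ s n ↔
      (Finset.univ.filter fun j => c j = 0) ⊆ b.2 ∧ ∑ i, b.1 i * a i + ∑ j ∈ b.2, c j = n)
    (hfin : {n | ∑ b ∈ s n, (-1 : ℤ) ^ (∑ i, b.1 i + b.2.card) ≠ 0}.Finite) :
    ∃ P : ℤ[X], (∀ n, P.coeff n = ∑ b ∈ s n, (-1 : ℤ) ^ (∑ i, b.1 i + b.2.card)) ∧ P ≠ 0 ∧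
      (X - 1) ^ (Finset.univ.filter fun j => c j ≠ 0).card ∣ P ∧
      Fintype.card Ie ≤ (Finset.univ.filter fun j => c j ≠ 0).card := by
  classical
  set T := Finset.univ.filter fun j => c j = 0 with hT
  set T' := Finset.univ.filter fun j => c j ≠ 0 with hT'
  set χ : ℕ → ℤ := fun n => ∑ b ∈ s n, (-1 : ℤ) ^ (∑ i, b.1 i + b.2.card) with hχ
  let P : ℤ[X] := ∑ n ∈ hfin.toFinset, monomial n (χ n)
  have hP : ∀ n, P.coeff n = χ n := by
    intro n
    simp only [P, finsetSum_coeff, coeff_monomial, Finset.sum_ite_eq', Set.Finite.mem_toFinset,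
      Set.mem_ofPred_eq]
    split_ifs with h
    · rfl
    · exact (not_not.mp h).symm
  let O : ℤ[X] := ∏ j, (-X ^ c j + if j ∈ T then 0 else 1)
  let G : ℤ[X] := ∏ i, (1 + X ^ a i)
  have hPG : P * G = O := by
    apply Polynomial.coe_injective
    have h1 : (P : PowerSeries ℤ) =
        (∏ i, PowerSeries.mk fun k => if a i ∣ k then (-1 : ℤ) ^ (k / a i) else 0) *
        ∏ j, (-PowerSeries.X ^ c j + if j ∈ T then 0 else 1) := by
      ext n
      rw [PowerSeries.coeff_prod_geom_mul_prod a (fun i => (ha i).pos) c T n (s n) (hs n),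
        Polynomial.coeff_coe, hP]
    have h2 : (G : PowerSeries ℤ) = ∏ i, (1 + PowerSeries.X ^ a i) := by
      rw [← Polynomial.coeToPowerSeries.ringHom_apply, map_prod]
      simp
    have h3 : (O : PowerSeries ℤ) = ∏ j, (-PowerSeries.X ^ c j + if j ∈ T then 0 else 1) := by
      rw [← Polynomial.coeToPowerSeries.ringHom_apply, map_prod]
      refine Finset.prod_congr rfl fun j _ => ?_
      split_ifs <;> simp
    rw [Polynomial.coe_mul, h1, h2, h3, mul_right_comm, ← Finset.prod_mul_distrib,
      Finset.prod_eq_one (fun i _ => PowerSeries.geom_mul_one_add (ha i).pos), one_mul]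
  have hO : O = (-1) ^ T.card * ∏ j ∈ T', (1 - X ^ c j) := by
    have h0 : ∀ j, (-X ^ c j + if j ∈ T then 0 else 1 : ℤ[X]) =
        if c j = 0 then -1 else 1 - X ^ c j := by
      intro j
      by_cases h : c j = 0 <;> simp [hT, h]
      ring
    simp only [O, h0]
    rw [Finset.prod_ite, Finset.prod_const]
  -- For even `c j ≠ 0` the zero at `-1` is simple, as the derivative does not vanish there.
  have hfac : ∀ j ∈ T', ∃ Q : ℤ[X], 1 - X ^ c j = (X + 1) * Q ∧ Q.eval (-1) ≠ 0 := by
    intro j hj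
    have h0 : c j ≠ 0 := (Finset.mem_filter.mp hj).2
    have hr : IsRoot (1 - X ^ c j : ℤ[X]) (-1) := by simp [(hc j).neg_pow]
    obtain ⟨Q, hQ⟩ := dvd_iff_isRoot.mpr hr
    refine ⟨Q, by simpa using hQ, fun h => ?_⟩
    have hd := congrArg (fun p => eval (-1) (derivative p)) hQ
    simp only [derivative_sub, derivative_one, derivative_X_pow, derivative_mul, derivative_X,
      derivative_C, eval_sub, eval_add, eval_mul, eval_pow, eval_X, eval_C, eval_one, eval_zero, h]
      at hd
    simp [h0] at hd
  have hX1 : (X - 1 : ℤ[X]) = X - C 1 := by simp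
  have hX1' : (X + 1 : ℤ[X]) = X - C (-1) := by simp
  have hOne : O ≠ 0 := by
    rw [hO]
    refine mul_ne_zero (pow_ne_zero _ (by simp)) (Finset.prod_ne_zero_iff.mpr fun j hj => ?_)
    obtain ⟨Q, hQ, hQ0⟩ := hfac j hj
    rw [hQ]
    refine mul_ne_zero (hX1' ▸ X_sub_C_ne_zero _) ?_
    rintro rfl
    simp at hQ0
  refine ⟨P, hP, ?_, ?_, ?_⟩
  · intro h
    rw [h, zero_mul] at hPG
    exact hOne hPG.symm
  · have hprime : Prime (X - 1 : ℤ[X]) := hX1 ▸ prime_X_sub_C 1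
    refine hprime.pow_dvd_of_dvd_mul_right _ (b := G) ?_ ?_
    -- Each factor of `G` takes the value 2 at 1, so the zero of `O` at 1 passes entirely to `P`.
    · rw [hX1, dvd_iff_isRoot, IsRoot, eval_prod, Finset.prod_eq_zero_iff]
      rintro ⟨i, _, hi⟩
      simp at hi
    · rw [hPG, hO, ← Finset.prod_const]
      refine Dvd.dvd.mul_left (Finset.prod_dvd_prod_of_dvd _ _ fun j _ => ?_) _
      rw [hX1, dvd_iff_isRoot]
      simp
  · have hprime : Prime (X + 1 : ℤ[X]) := hX1' ▸ prime_X_sub_C (-1)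
    -- Every `1 + X ^ a i` vanishes at `-1` because `a i` is odd, while the order of `O` there is
    -- exactly `T'.card`.
    have h1 : (X + 1 : ℤ[X]) ^ Fintype.card Ie ∣ O := by
      rw [← hPG]
      refine Dvd.dvd.mul_left ?_ _
      rw [← Finset.card_univ, ← Finset.prod_const]
      refine Finset.prod_dvd_prod_of_dvd _ _ fun i _ => ?_
      rw [hX1', dvd_iff_isRoot]
      simp [(ha i).neg_pow]
    choose! Q hQ hQ0 using hfac
    rw [hO, Finset.prod_congr rfl hQ, Finset.prod_mul_distrib, Finset.prod_const,
      mul_left_comm] at h1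
    refine (pow_dvd_pow_iff hprime.ne_zero hprime.not_isUnit).mp
      (hprime.pow_dvd_of_dvd_mul_right _ ?_ h1)
    rw [hX1', dvd_iff_isRoot, IsRoot, eval_mul, mul_eq_zero, eval_prod, Finset.prod_eq_zero_iff]
    rintro (h | ⟨j, hj, h⟩)
    · simp at h
    · exact hQ0 j hj h

end SignedCount

/-! ### Cohomology and Euler characteristics of graded families of subspaces -/

namespace GradedSubspaces

variable {K A : Type*} [Field K] [AddCommGroup A] [Module K A] (d : A →ₗ[K] A)
  (X : ℤ → Submodule K A)

/-- The cocycles of degree `k` in the graded family of subspaces `X`. -/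
def cocycles (k : ℤ) : Submodule K A := X k ⊓ LinearMap.ker d

/-- The coboundaries of degree `k` in the graded family of subspaces `X`. -/
def coboundaries (k : ℤ) : Submodule K A := (X (k - 1)).map d

/-- The dimension of the cohomology of degree `k` of the graded family of subspaces `X`. -/
noncomputable def cohomologyDim (k : ℤ) : ℤ :=
  Module.finrank K (cocycles d X k) - Module.finrank K (coboundaries d X k)

variable {d X}

theorem coboundaries_le_cocycles (hdd : ∀ a, d (d a) = 0) (hd : ∀ k, ∀ x ∈ X k, d x ∈ X (k + 1))
    (k : ℤ) : coboundaries d X k ≤ cocycles d X k := by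
  rintro _ ⟨y, hy, rfl⟩
  refine ⟨?_, hdd y⟩
  have := hd _ y hy
  rwa [sub_add_cancel] at this

variable [hfin : ∀ k, Module.Finite K (X k)]

instance (k : ℤ) : Module.Finite K (cocycles d X k) :=
  Submodule.finiteDimensional_of_le (inf_le_left : _ ≤ X k)

instance (k : ℤ) : Module.Finite K (coboundaries d X k) := by
  unfold coboundaries; infer_instance

theorem cohomologyDim_nonneg (hdd : ∀ a, d (d a) = 0) (hd : ∀ k, ∀ x ∈ X k, d x ∈ X (k + 1))
    (k : ℤ) : 0 ≤ cohomologyDim d X k := by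
  have := Submodule.finrank_mono (coboundaries_le_cocycles hdd hd k)
  unfold cohomologyDim
  omega

theorem cohomologyDim_pos_iff (hdd : ∀ a, d (d a) = 0) (hd : ∀ k, ∀ x ∈ X k, d x ∈ X (k + 1))
    (k : ℤ) : 0 < cohomologyDim d X k ↔ ∃ z ∈ X k, d z = 0 ∧ ∀ y ∈ X (k - 1), d y ≠ z := by
  have hle := coboundaries_le_cocycles hdd hd k
  constructor
  · intro h
    by_contra! hne
    have : cocycles d X k ≤ coboundaries d X k := by
      rintro z ⟨hz, hz0⟩
      obtain ⟨y, hy, rfl⟩ := hne z hz hz0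
      exact ⟨y, hy, rfl⟩
    have := Submodule.finrank_mono this
    unfold cohomologyDim at h
    omega
  · rintro ⟨z, hz, hz0, hne⟩
    have hlt : coboundaries d X k < cocycles d X k := by
      refine lt_of_le_of_ne hle fun h => ?_
      have hmem : z ∈ coboundaries d X k := h ▸ ⟨hz, hz0⟩
      obtain ⟨y, hy, hyz⟩ := hmem
      exact hne y hy hyz
    have := Submodule.finrank_lt_finrank_of_lt hlt
    unfold cohomologyDim
    omega

theorem finrank_eq (k : ℤ) : (Module.finrank K (X k) : ℤ) = cohomologyDim d X k +
    Module.finrank K (coboundaries d X k) + Module.finrank K (coboundaries d X (k + 1)) := by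
  have h := LinearMap.finrank_range_add_finrank_ker (d.domRestrict (X k))
  have h1 : (LinearMap.range (d.domRestrict (X k))) = coboundaries d X (k + 1) := by
    rw [LinearMap.range_domRestrict, coboundaries, add_sub_cancel_right]
  have h2 : Module.finrank K (LinearMap.ker (d.domRestrict (X k))) =
      Module.finrank K (cocycles d X k) := by
    have : (LinearMap.ker (d.domRestrict (X k))).map (X k).subtype = cocycles d X k := by
      ext z
      simp [cocycles, and_comm]
    exact (this ▸ LinearEquiv.finrank_eq (Submodule.equivMapOfInjective _ (X k).injective_subtype _))
  rw [h1, h2] at h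
  unfold cohomologyDim
  omega

/-- By `finrank_eq` the coboundary ranks telescope under alternating signs, and the two ends vanish.
-/
theorem euler_characteristic (N : ℕ) (h0 : X (-1) = ⊥) (hN : X N = ⊥) :
    ∑ k ∈ Finset.range (N + 1), (-1 : ℤ) ^ k * Module.finrank K (X k) =
      ∑ k ∈ Finset.range (N + 1), (-1 : ℤ) ^ k * cohomologyDim d X k := by
  have key : ∀ M : ℕ, ∑ k ∈ Finset.range M, (-1 : ℤ) ^ k * Module.finrank K (X k) =
      ∑ k ∈ Finset.range M, (-1 : ℤ) ^ k * cohomologyDim d X k -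
        (-1) ^ M * Module.finrank K (coboundaries d X M) := by
    intro M
    induction M with
    | zero =>
      have : coboundaries d X ((0 : ℕ) : ℤ) = ⊥ := by simp [coboundaries, h0]
      rw [this]
      simp
    | succ M ih =>
      rw [Finset.sum_range_succ, Finset.sum_range_succ, ih, finrank_eq (d := d) (X := X)]
      push_cast
      ring
  have : coboundaries d X ((N + 1 : ℕ) : ℤ) = ⊥ := by simp [coboundaries, hN]
  rw [key, this]
  simp

end GradedSubspaces

/-- If a sum of cocycles from the `Z i` is a coboundary, the projections put each summand in `B i`;
so the kernel of the map from `∏ Z i` to cohomology embeds in `∏ B i`. -/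
theorem sum_finrank_sub_le_finrank_cohomology {K A ι : Type*} [Field K] [AddCommGroup A]
    [Module K A] [Fintype ι] (d : A →ₗ[K] A) (Z B : ι → Submodule K A)
    [∀ i, Module.Finite K (Z i)] [∀ i, Module.Finite K (B i)]
    [Module.Finite K (LinearMap.ker d ⧸ (LinearMap.range d).submoduleOf (LinearMap.ker d))]
    (hZ : ∀ i, Z i ≤ LinearMap.ker d) (π : ι → A →ₗ[K] A)
    (hπ : ∀ i, ∀ z ∈ Z i, π i z = z) (hπ' : ∀ i j, i ≠ j → ∀ z ∈ Z j, π i z = 0)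
    (hπd : ∀ i y, π i (d y) ∈ B i) :
    ∑ i, ((Module.finrank K (Z i) : ℤ) - Module.finrank K (B i)) ≤
      Module.finrank K (LinearMap.ker d ⧸ (LinearMap.range d).submoduleOf (LinearMap.ker d)) := by
  classical
  let σ : (∀ i, Z i) →ₗ[K] LinearMap.ker d :=
    ∑ i, (Submodule.inclusion (hZ i)) ∘ₗ LinearMap.proj i
  have hσ : ∀ f, ((σ f : LinearMap.ker d) : A) = ∑ i, (f i : A) := by
    intro f
    simp [σ]
  let Φ := (Submodule.mkQ ((LinearMap.range d).submoduleOf (LinearMap.ker d))) ∘ₗ σ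
  have hker : ∀ f ∈ LinearMap.ker Φ, ∀ i, (f i : A) ∈ B i := by
    intro f hf i
    have h1 : σ f ∈ (LinearMap.range d).submoduleOf (LinearMap.ker d) := by
      simpa [Φ] using hf
    obtain ⟨y, hy⟩ : ((σ f : LinearMap.ker d) : A) ∈ LinearMap.range d := h1
    have h2 := hπd i y
    rw [hy, hσ, map_sum, Finset.sum_eq_single i] at h2
    · rwa [hπ i _ (f i).2] at h2
    · intro j _ hj
      exact hπ' i j hj.symm _ (f j).2
    · intro h
      exact absurd (Finset.mem_univ i) h
  let Ψ : LinearMap.ker Φ →ₗ[K] ∀ i, B i := LinearMap.pi fun i =>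
    LinearMap.codRestrict (B i)
      ((Z i).subtype ∘ₗ (LinearMap.proj i : (∀ i, Z i) →ₗ[K] Z i) ∘ₗ (LinearMap.ker Φ).subtype)
      fun f => hker f.1 f.2 i
  have hΨ : Function.Injective Ψ := by
    intro f g h
    refine Subtype.ext (funext fun i => Subtype.ext ?_)
    exact congrArg (fun x : ∀ i, B i => (x i : A)) h
  have h1 := LinearMap.finrank_le_finrank_of_injective hΨ
  have h2 := LinearMap.finrank_range_add_finrank_ker Φ
  have h3 := Submodule.finrank_le (LinearMap.range Φ)
  rw [Module.finrank_pi_fintype] at h1 h2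
  rw [Finset.sum_sub_distrib]
  have h4 : (∑ i, (Module.finrank K (Z i) : ℤ)) = ((∑ i, Module.finrank K (Z i) : ℕ) : ℤ) := by
    push_cast; rfl
  have h5 : (∑ i, (Module.finrank K (B i) : ℤ)) = ((∑ i, Module.finrank K (B i) : ℕ) : ℤ) := by
    push_cast; rfl
  rw [h4, h5]
  omega

/-! ### The Gysin argument -/

section Gysin

variable {K A : Type*} [Field K] [AddCommGroup A] [Module K A]

/-- In the short exact sequence `0 → X → X' → X → 0`, whose second map is `E`, the connecting map is
induced by `θ = d ∘ s` and is an endomorphism of `H^(k+1)(X)`. Its cokernel embeds in `H^(k+1)(X')`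
and its kernel is the image of `H^k(X')`. A nilpotent endomorphism of a nonzero space is neither
surjective nor injective. -/
theorem gysin_nonexact {d E s : A →ₗ[K] A} {X X' : ℤ → Submodule K A}
    (hdd : ∀ a, d (d a) = 0) (hd : ∀ k, ∀ x ∈ X' k, d x ∈ X' (k + 1))
    (hE : ∀ k, ∀ x ∈ X' k, E x ∈ X (k + 1)) (hs : ∀ k, ∀ x ∈ X (k + 1), s x ∈ X' k)
    (hEs : ∀ k, ∀ x ∈ X k, E (s x) = x) (hle : ∀ k, X k ≤ X' k)
    (hker : ∀ k, ∀ x ∈ X' k, E x = 0 ↔ x ∈ X k)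
    (hanti : ∀ k, ∀ x ∈ X' k, E (d x) = -d (E x))
    (hnil : ∀ k, ∃ n, ∀ z ∈ X k, ((d ∘ₗ s) ^ n) z = 0) (k : ℤ)
    (h : ∃ z ∈ X (k + 1), d z = 0 ∧ ∀ y ∈ X k, d y ≠ z) :
    (∃ z ∈ X' (k + 1), d z = 0 ∧ ∀ y ∈ X' k, d y ≠ z) ∧
      (∃ z ∈ X' k, d z = 0 ∧ ∀ y ∈ X' (k - 1), d y ≠ z) := by
  set θ := d ∘ₗ s with hθ
  obtain ⟨n, hn⟩ := hnil (k + 1)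
  have hθU : ∀ z ∈ X (k + 1), d z = 0 → θ z ∈ X (k + 1) ∧ d (θ z) = 0 := by
    intro z hz hz0
    refine ⟨(hker _ _ (hd _ _ (hs _ _ hz))).mp ?_, hdd _⟩
    rw [hanti _ _ (hs _ _ hz), hEs _ _ hz, hz0, neg_zero]
  have hθpow : ∀ i, ∀ z ∈ X (k + 1), d z = 0 → (θ ^ i) z ∈ X (k + 1) ∧ d ((θ ^ i) z) = 0 := by
    intro i
    induction i with
    | zero => intro z hz hz0; exact ⟨hz, hz0⟩
    | succ i ih =>
      intro z hz hz0
      rw [pow_succ', Module.End.mul_apply]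
      exact hθU _ (ih z hz hz0).1 (ih z hz hz0).2
  have hdX : ∀ x ∈ X k, d x ∈ X (k + 1) := by
    intro x hx
    refine (hker _ _ (hd _ _ (hle _ hx))).mp ?_
    rw [hanti _ _ (hle _ hx), (hker _ _ (hle _ hx)).mpr hx, map_zero, neg_zero]
  -- `s (d x)` is a primitive lying only in `X'`; adding the coboundary `d (s x)` moves it into `X`.
  have hθex : ∀ x ∈ X k, ∃ y ∈ X k, d y = θ (d x) := by
    intro x hx
    have hx' : x ∈ X (k - 1 + 1) := by rwa [sub_add_cancel]
    have h1 : d (s x) ∈ X' k := by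
      have := hd _ _ (hs _ _ hx')
      rwa [sub_add_cancel] at this
    have h2 : s (d x) + d (s x) ∈ X' k := add_mem (hs _ _ (hdX x hx)) h1
    refine ⟨s (d x) + d (s x), (hker _ _ h2).mp ?_, ?_⟩
    · rw [map_add, hEs _ _ (hdX x hx), hanti _ _ (hs _ _ hx'), hEs _ _ hx, add_neg_cancel]
    · rw [map_add, hdd, add_zero]; rfl
  obtain ⟨z, hz, hz0, hne⟩ := h
  constructor
  · by_contra! hall
    -- If `u = d w` in `X'`, then `w - s (E w)` lies in `X`, so `u` and `θ (E w)` are cohomologous: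
    -- `θ` would be surjective on cohomology, and so would all its powers.
    have key : ∀ i, ∀ z ∈ X (k + 1), d z = 0 →
        ∃ u ∈ X (k + 1), d u = 0 ∧ ∃ y ∈ X k, z = (θ ^ i) u + d y := by
      intro i
      induction i with
      | zero =>
        intro z hz hz0
        exact ⟨z, hz, hz0, 0, zero_mem _, by simp⟩
      | succ i ih =>
        intro z hz hz0
        obtain ⟨u, hu, hu0, y, hy, rfl⟩ := ih z hz hz0
        obtain ⟨w, hw, rfl⟩ := hall u (hle _ hu) hu0
        have hEw := hE _ _ hw
        have hsub : w - s (E w) ∈ X k := by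
          refine (hker _ _ (sub_mem hw (hs _ _ hEw))).mp ?_
          rw [map_sub, hEs _ _ hEw, sub_self]
        have hpow : ∀ j, ∀ x ∈ X k, ∃ y ∈ X k, d y = (θ ^ j) (d x) := by
          intro j
          induction j with
          | zero => intro x hx; exact ⟨x, hx, rfl⟩
          | succ j ihj =>
            intro x hx
            obtain ⟨y, hy, hxy⟩ := ihj x hx
            obtain ⟨y', hy', hxy'⟩ := hθex y hy
            exact ⟨y', hy', by rw [hxy', hxy, pow_succ']; rfl⟩
        obtain ⟨y', hy', hyy'⟩ := hpow i _ hsub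
        refine ⟨E w, hEw, ?_, y + y', add_mem hy hy', ?_⟩
        · rw [← neg_eq_zero, ← hanti _ _ hw, (hker _ _ (hle _ hu)).mpr hu]
        · rw [map_add, hyy', pow_succ, Module.End.mul_apply]
          have h3 : θ (E w) = d (s (E w)) := rfl
          rw [h3, map_sub, map_sub]
          abel
    obtain ⟨u, hu, _, y, hy, huy⟩ := key n z hz hz0
    rw [hn u hu, zero_add] at huy
    exact hne y hy huy.symm
  · classical
    -- At the least power of `θ` killing the class of `z`, the preceding power gives a nonzero class
    -- in the kernel of `θ`, which lifts along `E` to a cocycle of `X'`.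
    have hex : ∃ i, ∃ y ∈ X k, d y = (θ ^ i) z := ⟨n, 0, zero_mem _, by rw [hn z hz, map_zero]⟩
    obtain ⟨x, hx, hdx⟩ := Nat.find_spec hex
    have hmin := fun i => Nat.find_min hex (m := i)
    obtain ⟨i, hi⟩ : ∃ i, Nat.find hex = i + 1 := by
      refine Nat.exists_eq_succ_of_ne_zero fun h0 => ?_
      rw [h0] at hdx
      exact hne x hx hdx
    rw [hi, pow_succ'] at hdx
    obtain ⟨hzi, hzi0⟩ := hθpow i z hz hz0
    have hmini := hmin i (by omega)
    have hxs : s ((θ ^ i) z) - x ∈ X' k := sub_mem (hs _ _ hzi) (hle _ hx)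
    have hEx : E (s ((θ ^ i) z) - x) = (θ ^ i) z := by
      rw [map_sub, hEs _ _ hzi, (hker _ _ (hle _ hx)).mpr hx, sub_zero]
    refine ⟨_, hxs, ?_, ?_⟩
    · rw [map_sub, hdx, sub_eq_zero]; rfl
    · intro w hw hdw
      refine hmini ⟨-E w, neg_mem ?_, ?_⟩
      · have := hE _ _ hw
        rwa [sub_add_cancel] at this
      · rw [map_neg, ← hanti _ _ hw, hdw, hEx]

end Gysin

/-! ### Subspaces spanned by basis vectors -/

section BasisSpan

variable {K A B : Type*} [Field K] [AddCommGroup A] [Module K A] (e : Module.Basis B K A)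

/-- The span of the basis vectors whose index satisfies `Q`. -/
def basisSpan (Q : B → Prop) : Submodule K A := Submodule.span K (e '' {b | Q b})

variable {e}

theorem basis_mem_basisSpan {Q : B → Prop} {b : B} (hb : Q b) : e b ∈ basisSpan e Q :=
  Submodule.subset_span ⟨b, hb, rfl⟩

theorem basisSpan_le {Q : B → Prop} {N : Submodule K A} (h : ∀ b, Q b → e b ∈ N) :
    basisSpan e Q ≤ N :=
  Submodule.span_le.mpr (by rintro _ ⟨b, hb, rfl⟩; exact h b hb)

theorem basisSpan_mono {Q R : B → Prop} (h : ∀ b, Q b → R b) : basisSpan e Q ≤ basisSpan e R :=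
  basisSpan_le fun b hb => basis_mem_basisSpan (h b hb)

theorem map_mem_of_mem_basisSpan {A' : Type*} [AddCommGroup A'] [Module K A'] {Q : B → Prop}
    {N : Submodule K A'} {f : A →ₗ[K] A'} (h : ∀ b, Q b → f (e b) ∈ N) {x : A}
    (hx : x ∈ basisSpan e Q) : f x ∈ N :=
  basisSpan_le (N := N.comap f) h hx

theorem eqOn_basisSpan {A' : Type*} [AddCommGroup A'] [Module K A'] {Q : B → Prop}
    {f g : A →ₗ[K] A'} (h : ∀ b, Q b → f (e b) = g (e b)) {x : A} (hx : x ∈ basisSpan e Q) :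
    f x = g x :=
  basisSpan_le (N := LinearMap.eqLocus f g) h hx

theorem mem_basisSpan_iff {Q : B → Prop} {x : A} :
    x ∈ basisSpan e Q ↔ ∀ b, e.repr x b ≠ 0 → Q b := by
  rw [basisSpan, Module.Basis.mem_span_image]
  constructor
  · intro h b hb
    exact h (Finsupp.mem_support_iff.mpr hb)
  · intro h b hb
    exact h b (Finsupp.mem_support_iff.mp hb)

theorem basisSpan_and {Q R : B → Prop} {x : A} (hQ : x ∈ basisSpan e Q) (hR : x ∈ basisSpan e R) :
    x ∈ basisSpan e fun b => Q b ∧ R b := by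
  rw [mem_basisSpan_iff] at *
  exact fun b hb => ⟨hQ b hb, hR b hb⟩

theorem basisSpan_eq_bot {Q : B → Prop} (h : ∀ b, ¬Q b) : basisSpan e Q = ⊥ :=
  bot_unique (basisSpan_le fun b hb => absurd hb (h b))

theorem finite_basisSpan {Q : B → Prop} (h : {b | Q b}.Finite) : Module.Finite K (basisSpan e Q) :=
  FiniteDimensional.span_of_finite K (h.image e)

theorem finrank_basisSpan {Q : B → Prop} (s : Finset B) (hs : ∀ b, b ∈ s ↔ Q b) :
    Module.finrank K (basisSpan e Q) = s.card := by
  have h1 : basisSpan e Q = Submodule.span K (Set.range fun b : s => e b) := by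
    have h2 : e '' {b | Q b} = Set.range fun b : s => e b := by
      ext x
      simp [hs]
    rw [basisSpan, h2]
  rw [h1, ← Fintype.card_coe s]
  exact finrank_span_eq_card (e.linearIndependent.comp _ Subtype.val_injective)

open Classical in
/-- The projection onto the span of the basis vectors whose index satisfies `Q`. -/
noncomputable def basisProj (e : Module.Basis B K A) (Q : B → Prop) : A →ₗ[K] A :=
  e.constr K fun b => if Q b then e b else 0

theorem basisProj_of_pos {Q : B → Prop} {b : B} (h : Q b) : basisProj e Q (e b) = e b := by
  simp [basisProj, h]

theorem basisProj_of_neg {Q : B → Prop} {b : B} (h : ¬Q b) : basisProj e Q (e b) = 0 := by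
  simp [basisProj, h]

theorem basisProj_mem (Q : B → Prop) (x : A) : basisProj e Q x ∈ basisSpan e Q := by
  refine map_mem_of_mem_basisSpan (e := e) (Q := fun _ => True) (fun b _ => ?_) ?_
  · by_cases h : Q b
    · rw [basisProj_of_pos h]; exact basis_mem_basisSpan h
    · rw [basisProj_of_neg h]; exact zero_mem _
  · exact mem_basisSpan_iff.mpr fun _ _ => trivial

end BasisSpan

/-! ### Quadratic models and the ideals of degree-one generators -/

section Core

variable {Ie Io : Type*} [Fintype Ie]

/-- The additive weight of an exponent whose value at the generators is `f` and `g`. -/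
def exponentWeight (f : Ie → ℕ) (g : Io → ℕ) (b : (Ie →₀ ℕ) × Finset Io) : ℕ :=
  ∑ i, b.1 i * f i + ∑ j ∈ b.2, g j

/-- The word length of an exponent. -/
def exponentLength (b : (Ie →₀ ℕ) × Finset Io) : ℕ := ∑ i, b.1 i + b.2.card

theorem exponentWeight_insert [DecidableEq Io] (f : Ie → ℕ) (g : Io → ℕ) (α : Ie →₀ ℕ) {v : Io}
    {S : Finset Io} (hv : v ∉ S) :
    exponentWeight f g (α, insert v S) = g v + exponentWeight f g (α, S) := by
  simp only [exponentWeight, Finset.sum_insert hv]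
  omega

theorem exponentLength_insert [DecidableEq Io] (α : Ie →₀ ℕ) {v : Io} {S : Finset Io}
    (hv : v ∉ S) :
    exponentLength (α, insert v S) = exponentLength (α, S) + 1 := by
  simp only [exponentLength, Finset.card_insert_of_notMem hv]
  omega

theorem finite_exponentWeight_eq [Finite Io] {a : Ie → ℕ} (ha : ∀ i, 0 < a i) (c : Io → ℕ)
    (m : ℕ) : {b | exponentWeight a c b = m}.Finite := by
  classical
  have h1 : ((⇑) ⁻¹' Set.Icc 0 (fun _ => m) : Set (Ie →₀ ℕ)).Finite :=
    (Set.finite_Icc _ _).preimage DFunLike.coe_injective.injOn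
  refine (h1.prod (Set.finite_univ (α := Finset Io))).subset ?_
  rintro ⟨α, S⟩ h
  refine ⟨⟨fun i => Nat.zero_le _, fun i => ?_⟩, trivial⟩
  have h2 : α i * a i ≤ ∑ i, α i * a i :=
    Finset.single_le_sum (f := fun i => α i * a i) (fun _ _ => Nat.zero_le _) (Finset.mem_univ i)
  have h3 : α i ≤ α i * a i := Nat.le_mul_of_pos_right _ (ha i)
  have h4 : ∑ i, α i * a i + ∑ j ∈ S, c j = m := h
  change α i ≤ m
  omega

theorem exponentLength_le [Fintype Io] {a : Ie → ℕ} (ha : ∀ i, 0 < a i) (c : Io → ℕ)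
    (b : (Ie →₀ ℕ) × Finset Io) :
    exponentLength b ≤ exponentWeight a c b + Fintype.card Io := by
  have h1 : ∑ i, b.1 i ≤ ∑ i, b.1 i * a i :=
    Finset.sum_le_sum fun i _ => Nat.le_mul_of_pos_right _ (ha i)
  have h2 := Finset.card_le_univ b.2
  unfold exponentLength exponentWeight
  omega

variable [DecidableEq Io] {A : Type*} [AddCommGroup A] [Module ℚ A]

/-- A model of the free graded commutative algebra on even generators `Ie` of degrees `a + 1` and
odd generators `Io` of degrees `c + 1`, with a basis indexed by exponents, a quadratic differential
`d` and the multiplications `E v` by the odd generators. The function `w` is a weight for which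
`d` is strictly decreasing. -/
structure QuadraticModel (e : Module.Basis ((Ie →₀ ℕ) × Finset Io) ℚ A) (a : Ie → ℕ) (c : Io → ℕ)
    (d : A →ₗ[ℚ] A) : Type _ where
  a_odd : ∀ i, Odd (a i)
  c_even : ∀ j, Even (c j)
  d_d : ∀ x, d (d x) = 0
  we : Ie → ℕ
  wo : Io → ℕ
  d_basis : ∀ b, d (e b) ∈ basisSpan e fun b' => exponentLength b' = exponentLength b + 1 ∧
    exponentWeight a c b' = exponentWeight a c b ∧ exponentWeight we wo b' < exponentWeight we wo b
  E : Io → A →ₗ[ℚ] A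
  coef : Io → (Ie →₀ ℕ) × Finset Io → ℚ
  coef_ne_zero : ∀ v b, coef v b ≠ 0
  E_of_mem : ∀ v b, v ∈ b.2 → E v (e b) = 0
  E_of_notMem : ∀ v b, v ∉ b.2 → E v (e b) = coef v b • e (b.1, insert v b.2)
  E_anticomm : ∀ v (T : Finset Io), c v = 0 → (∀ j, c j = 0 → wo j < wo v → j ∈ T) →
    ∀ b, T ⊆ b.2 → E v (d (e b)) = -d (E v (e b))

namespace QuadraticModel

variable {e : Module.Basis ((Ie →₀ ℕ) × Finset Io) ℚ A} {a : Ie → ℕ} {c : Io → ℕ} {d : A →ₗ[ℚ] A}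

/-- The part of word length `k` and weight `m` of the ideal generated by the product of the
generators in `T`. -/
def part (e : Module.Basis ((Ie →₀ ℕ) × Finset Io) ℚ A) (a : Ie → ℕ) (c : Io → ℕ)
    (T : Finset Io) (m : ℕ) (k : ℤ) : Submodule ℚ A :=
  basisSpan e fun b => T ⊆ b.2 ∧ (exponentLength b : ℤ) = k ∧ exponentWeight a c b = m

variable (M : QuadraticModel e a c d)

/-- A section of the multiplication by the generator `v`. -/
noncomputable def sec (v : Io) : A →ₗ[ℚ] A :=
  e.constr ℚ fun b => if v ∈ b.2 then (M.coef v (b.1, b.2.erase v))⁻¹ • e (b.1, b.2.erase v) else 0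

theorem sec_of_mem {v : Io} {b} (h : v ∈ b.2) :
    M.sec v (e b) = (M.coef v (b.1, b.2.erase v))⁻¹ • e (b.1, b.2.erase v) := by
  simp [sec, h]

theorem sec_of_notMem {v : Io} {b} (h : v ∉ b.2) : M.sec v (e b) = 0 := by
  simp [sec, h]

theorem E_sec {v : Io} {x : A} (hx : x ∈ basisSpan e fun b => v ∈ b.2) : M.E v (M.sec v x) = x := by
  refine eqOn_basisSpan (f := M.E v ∘ₗ M.sec v) (g := LinearMap.id) (fun b hb => ?_) hx
  rw [LinearMap.comp_apply, M.sec_of_mem hb, map_smul, M.E_of_notMem _ _ (by simp), smul_smul,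
    inv_mul_cancel₀ (M.coef_ne_zero _ _), one_smul, Finset.insert_erase hb]
  rfl

theorem sec_E (v : Io) (x : A) : M.sec v (M.E v x) = x - basisProj e (fun b => v ∈ b.2) x := by
  have : M.sec v ∘ₗ M.E v = LinearMap.id - basisProj e (fun b => v ∈ b.2) := by
    refine e.ext fun b => ?_
    by_cases h : v ∈ b.2
    · simp [M.E_of_mem _ _ h, basisProj_of_pos (e := e) (Q := fun b => v ∈ b.2) h]
    · rw [LinearMap.comp_apply, M.E_of_notMem _ _ h, map_smul, M.sec_of_mem (by simp),
        LinearMap.sub_apply, basisProj_of_neg (e := e) (Q := fun b => v ∈ b.2) h]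
      simp [smul_smul, M.coef_ne_zero, Finset.erase_insert h]
  exact LinearMap.congr_fun this x

/-- A set of generators of degree one that contains all generators of smaller weight. -/
def Lower (T : Finset Io) : Prop :=
  ∀ v ∈ T, c v = 0 ∧ ∀ j, c j = 0 → M.wo j < M.wo v → j ∈ T

/-- Removing an element of maximal `wo` leaves a lower set that contains every degree-one generator
of smaller `wo`, which is what `E_anticomm` requires. -/
theorem Lower.induction {P : Finset Io → Prop} (h0 : P ∅)
    (h1 : ∀ T v, v ∉ T → M.Lower (insert v T) → M.Lower T →
      (∀ j, c j = 0 → M.wo j < M.wo v → j ∈ T) → P T → P (insert v T)) :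
    ∀ T, M.Lower T → P T := by
  intro T
  induction hn : T.card generalizing T with
  | zero =>
    intro _
    rw [Finset.card_eq_zero.mp hn]
    exact h0
  | succ n ih =>
    intro hT
    have hne : T.Nonempty := Finset.card_pos.mp (by omega)
    obtain ⟨v, hv, hmax⟩ := T.exists_max_image M.wo hne
    have hlow : ∀ j, c j = 0 → M.wo j < M.wo v → j ∈ T.erase v := by
      intro j hj hjv
      refine Finset.mem_erase.mpr ⟨?_, (hT v hv).2 j hj hjv⟩
      rintro rfl
      exact lt_irrefl _ hjv
    have hT' : M.Lower (T.erase v) := by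
      intro i hi
      have hiT := Finset.mem_of_mem_erase hi
      exact ⟨(hT i hiT).1, fun j hj hji => hlow j hj (hji.trans_le (hmax i hiT))⟩
    have := h1 (T.erase v) v (Finset.notMem_erase v T) (by rwa [Finset.insert_erase hv]) hT' hlow
      (ih _ (by rw [Finset.card_erase_of_mem hv]; omega) hT')
    rwa [Finset.insert_erase hv] at this

theorem E_anticomm_of_mem {v : Io} {T : Finset Io} (hv : c v = 0)
    (hT : ∀ j, c j = 0 → M.wo j < M.wo v → j ∈ T) {x : A}
    (hx : x ∈ basisSpan e fun b => T ⊆ b.2) : M.E v (d x) = -d (M.E v x) :=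
  eqOn_basisSpan (f := M.E v ∘ₗ d) (g := -(d ∘ₗ M.E v)) (M.E_anticomm v T hv hT) hx

theorem E_eq_zero_iff {v : Io} {x : A} : M.E v x = 0 ↔ x ∈ basisSpan e fun b => v ∈ b.2 := by
  constructor
  · intro h
    have := M.sec_E v x
    rw [h, map_zero, eq_comm, sub_eq_zero] at this
    rw [this]
    exact basisProj_mem _ _
  · intro h
    exact eqOn_basisSpan (f := M.E v) (g := 0) (fun b hb => M.E_of_mem v b hb) h

/-- Inside the ideal of `T`, the ideal of `insert v T` is the kernel of `E v`, and there `E v`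
anticommutes with `d`. -/
theorem d_mem_ideal : ∀ T, M.Lower T → ∀ x ∈ basisSpan e (fun b => T ⊆ b.2),
    d x ∈ basisSpan e fun b => T ⊆ b.2 := by
  refine Lower.induction M ?_ ?_
  · intro x _
    exact mem_basisSpan_iff.mpr fun _ _ => Finset.empty_subset _
  · intro T v hvT hi hT hv ih x hx
    have h1 : x ∈ basisSpan e fun b => T ⊆ b.2 :=
      basisSpan_mono (fun b hb => (Finset.subset_insert v T).trans hb) hx
    have h2 : x ∈ basisSpan e fun b => v ∈ b.2 :=
      basisSpan_mono (fun b hb => hb (Finset.mem_insert_self v T)) hx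
    have h3 : M.E v (d x) = 0 := by
      rw [M.E_anticomm_of_mem (hi v (Finset.mem_insert_self v T)).1 hv h1, M.E_eq_zero_iff.mpr h2,
        map_zero, neg_zero]
    exact basisSpan_mono (fun b hb => Finset.insert_subset hb.1 hb.2)
      (basisSpan_and (M.E_eq_zero_iff.mp h3) (ih x h1))

theorem d_mem_part {T : Finset Io} (hT : M.Lower T) (m : ℕ) (k : ℤ) (x : A)
    (hx : x ∈ part e a c T m k) : d x ∈ part e a c T m (k + 1) := by
  have h1 := M.d_mem_ideal T hT x (basisSpan_mono (fun b hb => hb.1) hx)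
  have h2 : d x ∈ basisSpan e fun b =>
      (exponentLength b : ℤ) = k + 1 ∧ exponentWeight a c b = m := by
    refine map_mem_of_mem_basisSpan (fun b hb => ?_) hx
    refine basisSpan_mono (fun b' hb' => ?_) (M.d_basis b)
    have := hb.2
    omega
  exact basisSpan_and h1 h2

omit [DecidableEq Io] in
theorem finite_part [Finite Io] (ha : ∀ i, 0 < a i) (T : Finset Io) (m : ℕ) (k : ℤ) : Module.Finite ℚ (part e a c T m k) :=
  finite_basisSpan ((finite_exponentWeight_eq ha c m).subset
    fun _ hb => hb.2.2)

/-- Deleting `v` does not raise the filtration weight given by `we` and `wo`, and `d` strictly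
lowers it. -/
theorem comp_sec_pow_eq_zero (v : Io) (n : ℕ) : ∀ x ∈ basisSpan e
    (fun b => exponentWeight M.we M.wo b < n), ((d ∘ₗ M.sec v) ^ n) x = 0 := by
  induction n with
  | zero =>
    intro x hx
    rw [basisSpan_eq_bot (by simp)] at hx
    simpa using hx
  | succ n ih =>
    intro x hx
    rw [pow_succ, Module.End.mul_apply]
    refine ih _ (map_mem_of_mem_basisSpan (fun b hb => ?_) hx)
    by_cases hv : v ∈ b.2
    · rw [LinearMap.comp_apply, M.sec_of_mem hv, map_smul]
      refine Submodule.smul_mem _ _ (basisSpan_mono (fun b' hb' => ?_) (M.d_basis _))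
      have h1 := exponentWeight_insert M.we M.wo b.1 (Finset.notMem_erase v b.2)
      rw [Finset.insert_erase hv] at h1
      have h2 : exponentWeight M.we M.wo (b.1, b.2) < n + 1 := hb
      have := hb'.2.2
      omega
    · rw [LinearMap.comp_apply, M.sec_of_notMem hv, map_zero]
      exact zero_mem _

/-- As `c v = 0`, multiplication by `v` keeps the weight `m` and raises word length by one, so the
Gysin argument applies within a single weight. -/
theorem nonexact_of_insert [Finite Io] {T : Finset Io} {v : Io} (hvT : v ∉ T) (hi : M.Lower (insert v T))
    (hT : M.Lower T) (hv : ∀ j, c j = 0 → M.wo j < M.wo v → j ∈ T) (m : ℕ) (k : ℤ)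
    (h : ∃ z ∈ part e a c (insert v T) m (k + 1), d z = 0 ∧
      ∀ y ∈ part e a c (insert v T) m k, d y ≠ z) :
    (∃ z ∈ part e a c T m (k + 1), d z = 0 ∧ ∀ y ∈ part e a c T m k, d y ≠ z) ∧
      (∃ z ∈ part e a c T m k, d z = 0 ∧ ∀ y ∈ part e a c T m (k - 1), d y ≠ z) := by
  have hcv := (hi v (Finset.mem_insert_self v T)).1
  have hle : ∀ k, part e a c (insert v T) m k ≤ part e a c T m k := fun k =>
    basisSpan_mono fun b hb => ⟨(Finset.subset_insert v T).trans hb.1, hb.2⟩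
  have hvmem : ∀ k, ∀ x ∈ part e a c (insert v T) m k, x ∈ basisSpan e fun b => v ∈ b.2 :=
    fun k x hx => basisSpan_mono (fun b hb => hb.1 (Finset.mem_insert_self v T)) hx
  refine gysin_nonexact (E := M.E v) (s := M.sec v) M.d_d (M.d_mem_part hT m) ?_ ?_ ?_ hle ?_ ?_ ?_
    k h
  · intro k x hx
    refine map_mem_of_mem_basisSpan (fun b hb => ?_) hx
    by_cases hvb : v ∈ b.2
    · rw [M.E_of_mem _ _ hvb]; exact zero_mem _
    · rw [M.E_of_notMem _ _ hvb]
      refine Submodule.smul_mem _ _ (basis_mem_basisSpan ⟨Finset.insert_subset_insert _ hb.1, ?_, ?_⟩)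
      · rw [exponentLength_insert _ hvb, ← hb.2.1]; rfl
      · rw [exponentWeight_insert _ _ _ hvb, hcv, zero_add]; exact hb.2.2
  · intro k x hx
    refine map_mem_of_mem_basisSpan (fun b hb => ?_) hx
    have hvb : v ∈ b.2 := hb.1 (Finset.mem_insert_self v T)
    rw [M.sec_of_mem hvb]
    have h1 := exponentWeight_insert a c b.1 (Finset.notMem_erase v b.2)
    have h2 := exponentLength_insert b.1 (Finset.notMem_erase v b.2)
    rw [Finset.insert_erase hvb] at h1 h2
    refine Submodule.smul_mem _ _ (basis_mem_basisSpan ⟨?_, ?_, ?_⟩)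
    · exact fun i hi => Finset.mem_erase.mpr ⟨fun h => hvT (h ▸ hi),
        hb.1 (Finset.mem_insert_of_mem hi)⟩
    · have := hb.2.1
      change (exponentLength (b.1, b.2) : ℤ) = _ at this
      omega
    · have := hb.2.2
      change exponentWeight a c (b.1, b.2) = _ at this
      omega
  · exact fun k x hx => M.E_sec (hvmem k x hx)
  · intro k x hx
    rw [M.E_eq_zero_iff]
    refine ⟨fun h => ?_, hvmem k x⟩
    exact basisSpan_mono (fun b hb => ⟨Finset.insert_subset hb.1 hb.2.1, hb.2.2⟩)
      (basisSpan_and h hx)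
  · exact fun k x hx => M.E_anticomm_of_mem hcv hv (basisSpan_mono (fun b hb => hb.1) hx)
  · intro k
    have hf := finite_exponentWeight_eq (fun i => (M.a_odd i).pos) c m
    refine ⟨hf.toFinset.sup (exponentWeight M.we M.wo) + 1, fun z hz => ?_⟩
    refine M.comp_sec_pow_eq_zero v _ z (basisSpan_mono (fun b hb => ?_) hz)
    have := Finset.le_sup (f := exponentWeight M.we M.wo) (hf.mem_toFinset.mpr hb.2.2)
    omega

/-- Each removal of a generator keeps nonzero cohomology in the given word length and produces some
one length below, so the range grows by one every time. -/
theorem nonexact_of_lower [Finite Io] (m : ℕ) : ∀ T, M.Lower T → ∀ k : ℤ,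
    (∃ z ∈ part e a c T m k, d z = 0 ∧ ∀ y ∈ part e a c T m (k - 1), d y ≠ z) →
    ∀ i ≤ T.card, ∃ z ∈ part e a c ∅ m (k - i), d z = 0 ∧
      ∀ y ∈ part e a c ∅ m (k - i - 1), d y ≠ z := by
  refine Lower.induction M ?_ ?_
  · intro k h i hi
    obtain rfl : i = 0 := by simpa using hi
    simpa using h
  · intro T v hvT hi hT hv ih k h i hicard
    rw [Finset.card_insert_of_notMem hvT] at hicard
    have h1 := M.nonexact_of_insert hvT hi hT hv m (k - 1) (by rwa [sub_add_cancel])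
    rw [sub_add_cancel] at h1
    rcases Nat.lt_or_ge T.card i with hlt | hle
    · obtain ⟨i, rfl⟩ : ∃ i', i = i' + 1 := ⟨i - 1, by omega⟩
      have := ih _ h1.2 i (by omega)
      push_cast
      rwa [sub_sub, add_comm (1 : ℤ)] at this
    · exact ih _ h1.1 i hle

end QuadraticModel

end Core

/-! ### The lower bound for a quadratic model -/

section CoreBound

open GradedSubspaces

variable {Ie Io : Type*} [Fintype Ie] [Fintype Io] [DecidableEq Io] {A : Type*} [AddCommGroup A]
  [Module ℚ A]

namespace QuadraticModel

variable {e : Module.Basis ((Ie →₀ ℕ) × Finset Io) ℚ A} {a : Ie → ℕ} {c : Io → ℕ} {d : A →ₗ[ℚ] A}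

omit [Fintype Io] in
theorem d_basisProj (M : QuadraticModel e a c d) (m : ℕ) (k : ℤ) (y : A) :
    basisProj e (fun b => (exponentLength b : ℤ) = k ∧ exponentWeight a c b = m) (d y) =
      d (basisProj e (fun b => (exponentLength b : ℤ) = k - 1 ∧ exponentWeight a c b = m) y) := by
  refine LinearMap.congr_fun (f := basisProj e _ ∘ₗ d) (g := d ∘ₗ basisProj e _)
    (e.ext fun b => ?_) y
  rw [LinearMap.comp_apply, LinearMap.comp_apply]
  by_cases hb : (exponentLength b : ℤ) = k - 1 ∧ exponentWeight a c b = m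
  · rw [basisProj_of_pos (e := e)
      (Q := fun b => (exponentLength b : ℤ) = k - 1 ∧ exponentWeight a c b = m) hb]
    refine eqOn_basisSpan (g := LinearMap.id) (fun b' hb' => ?_) (M.d_basis b)
    refine basisProj_of_pos ⟨?_, ?_⟩ <;> omega
  · rw [basisProj_of_neg (e := e)
      (Q := fun b => (exponentLength b : ℤ) = k - 1 ∧ exponentWeight a c b = m) hb, map_zero]
    refine eqOn_basisSpan (g := 0) (fun b' hb' => ?_) (M.d_basis b)
    refine basisProj_of_neg fun h => hb ⟨?_, ?_⟩ <;> omega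

/-- Distinct pairs of weight and word length index independent summands of the cohomology, because
projecting to such a pair commutes with `d` up to the length shift. -/
theorem sum_cohomologyDim_le
    [Module.Finite ℚ (LinearMap.ker d ⧸ (LinearMap.range d).submoduleOf (LinearMap.ker d))]
    (M : QuadraticModel e a c d) {κ : Type*} [Fintype κ] (f : κ → ℕ × ℤ) (hf : Function.Injective f) :
    ∑ i, cohomologyDim d (part e a c ∅ (f i).1) (f i).2 ≤
      Module.finrank ℚ (LinearMap.ker d ⧸ (LinearMap.range d).submoduleOf (LinearMap.ker d)) := by
  have hfin : ∀ m k, Module.Finite ℚ (part e a c ∅ m k) :=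
    finite_part (fun i => (M.a_odd i).pos) ∅
  refine sum_finrank_sub_le_finrank_cohomology d (fun i => cocycles d (part e a c ∅ (f i).1) (f i).2)
    (fun i => coboundaries d (part e a c ∅ (f i).1) (f i).2) (fun i => inf_le_right)
    (fun i => basisProj e fun b => (exponentLength b : ℤ) = (f i).2 ∧ exponentWeight a c b = (f i).1)
    ?_ ?_ ?_
  · intro i z hz
    exact eqOn_basisSpan (g := LinearMap.id) (fun b hb => basisProj_of_pos hb.2) hz.1
  · intro i j hij z hz
    refine eqOn_basisSpan (g := 0) (fun b hb => basisProj_of_neg fun h => ?_) hz.1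
    exact hij (hf (Prod.ext (h.2.symm.trans hb.2.2) (h.1.symm.trans hb.2.1)))
  · intro i y
    rw [M.d_basisProj]
    refine ⟨_, ?_, rfl⟩
    exact basisSpan_mono (fun b hb => ⟨Finset.empty_subset _, hb⟩) (basisProj_mem _ y)

theorem euler_characteristic_part (M : QuadraticModel e a c d) {T : Finset Io} (m : ℕ)
    (s : Finset ((Ie →₀ ℕ) × Finset Io)) (hs : ∀ b, b ∈ s ↔ T ⊆ b.2 ∧ exponentWeight a c b = m)
    {N : ℕ} (hN : m + Fintype.card Io < N) :
    ∑ b ∈ s, (-1 : ℤ) ^ exponentLength b =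
      ∑ k ∈ Finset.range (N + 1), (-1 : ℤ) ^ k * cohomologyDim d (part e a c T m) k := by
  have ha : ∀ i, 0 < a i := fun i => (M.a_odd i).pos
  have hfin : ∀ k, Module.Finite ℚ (part e a c T m k) := finite_part ha T m
  rw [← euler_characteristic (d := d) (X := part e a c T m) N]
  · rw [← Finset.sum_fiberwise_of_maps_to (s := s) (t := Finset.range (N + 1)) (g := exponentLength)]
    · refine Finset.sum_congr rfl fun k _ => ?_
      rw [part, finrank_basisSpan (s.filter fun b => exponentLength b = k)]
      · rw [Finset.sum_congr rfl (g := fun _ => (-1 : ℤ) ^ k)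
          fun b hb => by rw [(Finset.mem_filter.mp hb).2]]
        rw [Finset.sum_const, nsmul_eq_mul, mul_comm]
      · intro b
        rw [Finset.mem_filter, hs, Nat.cast_inj]
        tauto
    · intro b hb
      have h1 := exponentLength_le ha c b
      have h2 := ((hs b).mp hb).2
      rw [Finset.mem_range]
      omega
  · refine basisSpan_eq_bot fun b hb => ?_
    have := hb.2.1
    omega
  · refine basisSpan_eq_bot fun b hb => ?_
    have h1 := exponentLength_le ha c b
    have := hb.2
    omega

theorem card_le_finrank_cohomology
    [Module.Finite ℚ (LinearMap.ker d ⧸ (LinearMap.range d).submoduleOf (LinearMap.ker d))]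
    (M : QuadraticModel e a c d) : Fintype.card Ie + Fintype.card Io ≤
    Module.finrank ℚ (LinearMap.ker d ⧸ (LinearMap.range d).submoduleOf (LinearMap.ker d)) := by
  classical
  have ha : ∀ i, 0 < a i := fun i => (M.a_odd i).pos
  have hfin : ∀ T m k, Module.Finite ℚ (part e a c T m k) := finite_part ha
  set T := Finset.univ.filter fun j => c j = 0 with hTdef
  set T' := Finset.univ.filter fun j => c j ≠ 0 with hTdef'
  have hcard : Fintype.card Io = T.card + T'.card := by
    rw [hTdef, hTdef', Finset.card_filter_add_card_filter_not, Finset.card_univ]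
  have hTlow : M.Lower T := fun v hv => ⟨(Finset.mem_filter.mp hv).2,
    fun j hj _ => Finset.mem_filter.mpr ⟨Finset.mem_univ j, hj⟩⟩
  have h0low : M.Lower ∅ := fun v hv => absurd hv (Finset.notMem_empty v)
  have hsfin : ∀ m, {b | T ⊆ b.2 ∧ exponentWeight a c b = m}.Finite := fun m =>
    (finite_exponentWeight_eq ha c m).subset fun b hb => hb.2
  set s := fun m => (hsfin m).toFinset with hsdef
  have hs : ∀ m b, b ∈ s m ↔ T ⊆ b.2 ∧ exponentWeight a c b = m := fun m b => by simp [s]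
  set χ : ℕ → ℤ := fun m => ∑ b ∈ s m, (-1 : ℤ) ^ exponentLength b with hχ
  set h := Module.finrank ℚ
    (LinearMap.ker d ⧸ (LinearMap.range d).submoduleOf (LinearMap.ker d)) with hh
  have hne : ∀ m, χ m ≠ 0 → ∃ k : ℤ, ∀ i ≤ T.card,
      1 ≤ cohomologyDim d (part e a c ∅ m) (k - i) := by
    intro m hm
    have h1 := M.euler_characteristic_part m (s m) (hs m) (Nat.lt_succ_self _)
    have hm' : ∑ b ∈ s m, (-1 : ℤ) ^ exponentLength b ≠ 0 := hm
    rw [h1] at hm'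
    obtain ⟨k, _, hk⟩ := Finset.exists_ne_zero_of_sum_ne_zero hm'
    have h2 : 0 < cohomologyDim d (part e a c T m) k :=
      lt_of_le_of_ne (cohomologyDim_nonneg M.d_d (M.d_mem_part hTlow m) k)
        (right_ne_zero_of_mul hk).symm
    rw [cohomologyDim_pos_iff M.d_d (M.d_mem_part hTlow m)] at h2
    refine ⟨k, fun i hi => ?_⟩
    exact (cohomologyDim_pos_iff M.d_d (M.d_mem_part h0low m) _).mpr
      (M.nonexact_of_lower m T hTlow k h2 i hi)
  have hbound : ∀ S : Finset ℕ, (∀ m ∈ S, χ m ≠ 0) → S.card * (T.card + 1) ≤ h := by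
    intro S hS
    choose! k hk using fun m hm => hne m (hS m hm)
    have h1 := M.sum_cohomologyDim_le (κ := S × Fin (T.card + 1))
      (fun x => (x.1, k x.1 - (x.2 : ℕ))) (by
        rintro ⟨⟨m, hm⟩, i⟩ ⟨⟨m', hm'⟩, i'⟩ hii
        simp only [Prod.mk.injEq] at hii
        obtain ⟨rfl, h2⟩ := hii
        simp only [Prod.mk.injEq, true_and]
        exact Fin.ext (by omega))
    have h2 : ∑ _x : S × Fin (T.card + 1), (1 : ℤ) ≤ h :=
      (Finset.sum_le_sum fun x _ => hk x.1 x.1.2 x.2 (by omega)).trans h1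
    simp only [Finset.sum_const, Finset.card_univ, Fintype.card_prod, Fintype.card_coe,
      Fintype.card_fin, nsmul_eq_mul, mul_one] at h2
    exact_mod_cast h2
  -- Any `h + 1` weights with `χ m ≠ 0` would already force more than `h` dimensions.
  have hχfin : {m | χ m ≠ 0}.Finite := by
    by_contra hinf
    obtain ⟨S, hS, hScard⟩ := Set.Infinite.exists_subset_card_eq hinf (h + 1)
    have := hbound S fun m hm => hS hm
    rw [hScard] at this
    nlinarith
  obtain ⟨P, hP, hP0, hdvd, hle⟩ :=
    exists_polynomial_of_signedCount a M.a_odd c M.c_even s hs hχfin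
  replace hP : ∀ m, P.coeff m = χ m := hP
  rw [← hTdef'] at hdvd hle
  have h1 := Polynomial.lt_card_support_of_pow_dvd hP0 hdvd
  have h2 := hbound P.support fun m hm => by rw [← hP]; exact Polynomial.mem_support_iff.mp hm
  -- Without degree-one generators, counting nonzero coefficients gives only `T'.card + 1`, so their
  -- absolute values are needed; here the ideal is the whole algebra.
  rcases Nat.eq_zero_or_pos T.card with hT0 | hTpos
  · have h3 := Polynomial.two_mul_le_sum_abs_coeff hP0 hdvd
    have hTe : T = ∅ := Finset.card_eq_zero.mp hT0
    set N := P.support.sup id + Fintype.card Io + 1 with hN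
    have h4 : ∀ m ∈ P.support, |P.coeff m| ≤
        ∑ k ∈ Finset.range (N + 1), cohomologyDim d (part e a c ∅ m) k := by
      intro m hm
      have hmN : m + Fintype.card Io < N := by
        have : id m ≤ P.support.sup id := Finset.le_sup hm
        simp only [id] at this
        omega
      rw [hP, hχ]
      dsimp only
      rw [M.euler_characteristic_part m (s m) (hs m) hmN, hTe]
      refine (Finset.abs_sum_le_sum_abs _ _).trans (Finset.sum_le_sum fun k _ => ?_)
      rw [abs_mul, abs_pow, abs_neg, abs_one, one_pow, one_mul,
        abs_of_nonneg (cohomologyDim_nonneg M.d_d (M.d_mem_part h0low m) k)]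
    have h5 := M.sum_cohomologyDim_le (κ := P.support × Fin (N + 1))
      (fun x => (x.1, ((x.2 : ℕ) : ℤ))) (by
        rintro ⟨⟨m, hm⟩, i⟩ ⟨⟨m', hm'⟩, i'⟩ hii
        simp only [Prod.mk.injEq] at hii
        obtain ⟨rfl, h2⟩ := hii
        simp only [Prod.mk.injEq, true_and]
        exact Fin.ext (by omega))
    rw [Fintype.sum_prod_type] at h5
    simp only at h5
    have h6 : ∑ m ∈ P.support, |P.coeff m| ≤ h := by
      refine (Finset.sum_le_sum h4).trans ?_
      rw [← Finset.sum_coe_sort]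
      refine le_trans (le_of_eq ?_) h5
      refine Finset.sum_congr rfl fun m _ => ?_
      rw [Finset.sum_range]
    omega
  · have h3 : (T'.card + 1) * (T.card + 1) ≤ h := (Nat.mul_le_mul_right _ h1).trans h2
    nlinarith

end QuadraticModel

end CoreBound

/-! ### The monomial basis of an exterior algebra -/

section ExteriorAlgebraBasis

variable {R M I : Type*} [LinearOrder I] [CommRing R] [AddCommGroup M] [Module R M]
  (b : Basis I R M)

theorem Module.Basis.exteriorAlgebra_mul_of_not_disjoint {s t : Finset I} (h : ¬Disjoint s t) :
    b.ExteriorAlgebra s * b.ExteriorAlgebra t = 0 :=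
  ExteriorAlgebra.basis_mul_of_not_disjoint b (Set.powersetCard.ofCard (rfl : s.card = _))
    (Set.powersetCard.ofCard (rfl : t.card = _)) h

theorem Module.Basis.exteriorAlgebra_mul_of_disjoint {s t : Finset I} (h : Disjoint s t) :
    ∃ ε : ℤˣ, b.ExteriorAlgebra s * b.ExteriorAlgebra t = ε • b.ExteriorAlgebra (s ∪ t) := by
  let s' : Set.powersetCard I s.card := Set.powersetCard.ofCard rfl
  let t' : Set.powersetCard I t.card := Set.powersetCard.ofCard rfl
  have h' : Disjoint s'.val t'.val := h
  have hu : ((Set.powersetCard.disjUnion h' : Set.powersetCard I _) : Finset I) = s ∪ t :=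
    Finset.disjUnion_eq_union s t h
  exact ⟨(Set.powersetCard.permOfDisjoint h').sign,
    hu ▸ ExteriorAlgebra.basis_mul_of_disjoint b s' t' h'⟩

theorem Module.Basis.exteriorAlgebra_empty : b.ExteriorAlgebra ∅ = 1 := by
  rw [ExteriorAlgebra.basis_apply_ofCard b Finset.card_empty]
  simp

theorem Module.Basis.exteriorAlgebra_singleton (i : I) :
    b.ExteriorAlgebra {i} = ExteriorAlgebra.ι R (b i) := by
  rw [ExteriorAlgebra.basis_apply_ofCard b (Finset.card_singleton i)]
  have h : Set.powersetCard.ofFinEmbEquiv.symm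
      (Set.powersetCard.ofCard (Finset.card_singleton i)) 0 = i := by
    have := Set.powersetCard.mem_range_ofFinEmbEquiv_symm_iff_mem
      (Set.powersetCard.ofCard (Finset.card_singleton i))
    exact Finset.mem_singleton.mp ((this _).mp ⟨0, rfl⟩)
  simp [h]

end ExteriorAlgebraBasis

/-! ### Bases adapted to a filtration -/

section AdaptedBasis

variable {K W : Type*} [Field K] [AddCommGroup W] [Module K W]

/-- A vector space that is exhausted by an increasing sequence of subspaces has a basis adapted to
the sequence. -/
theorem exists_basis_adapted (F : ℕ → Submodule K W) (hF : Monotone F) (hex : ∀ v, ∃ k, v ∈ F k) :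
    ∃ (s : Set W) (b : Basis s K W) (ρ : s → ℕ), (∀ i, b i ∈ F (ρ i)) ∧
      ∀ k, F k ≤ Submodule.span K (b '' {i | ρ i ≤ k}) := by
  classical
  have h0 : ∃ t ⊆ (F 0 : Set W), (∅ : Set W) ⊆ t ∧ (F 0 : Set W) ⊆ Submodule.span K t ∧
      LinearIndepOn K id t :=
    exists_linearIndepOn_id_extension (linearIndepOn_empty K id) (Set.empty_subset _)
  let G := fun k => {t : Set W // t ⊆ F k ∧ (F k : Set W) ⊆ Submodule.span K t ∧
    LinearIndepOn K id t}
  have hstep : ∀ k, ∀ t : G k, ∃ t' : G (k + 1), t.1 ⊆ t'.1 := by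
    rintro k ⟨t, ht1, _, ht3⟩
    obtain ⟨t', h1, h2, h3, h4⟩ := exists_linearIndepOn_id_extension ht3
      (ht1.trans (hF (Nat.le_succ k)))
    exact ⟨⟨t', h1, h3, h4⟩, h2⟩
  choose next hnext using hstep
  let S : ∀ k, G k := fun k => Nat.rec ⟨h0.choose, h0.choose_spec.1, h0.choose_spec.2.2⟩ next k
  have hS : ∀ k, (S k).1 ⊆ (S (k + 1)).1 := fun k => hnext k (S k)
  have hmono : Monotone fun k => (S k).1 := monotone_nat_of_le_succ hS
  let s := ⋃ k, (S k).1
  have hli : LinearIndependent K ((↑) : s → W) :=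
    linearIndepOn_iUnion_of_directed hmono.directed_le fun k => (S k).2.2.2
  have hspan : ⊤ ≤ Submodule.span K (Set.range ((↑) : s → W)) := by
    rw [Subtype.range_coe]
    intro v _
    obtain ⟨k, hk⟩ := hex v
    exact Submodule.span_mono (Set.subset_iUnion _ k) ((S k).2.2.1 hk)
  have hmem : ∀ i : s, ∃ k, (i : W) ∈ (S k).1 := fun i => Set.mem_iUnion.mp i.2
  obtain ⟨b, hb⟩ : ∃ b : Basis s K W, ∀ i, b i = i :=
    ⟨Basis.mk hli hspan, fun i => Basis.mk_apply hli hspan i⟩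
  -- The rank of a basis vector is the first stage of the construction at which it appears.
  refine ⟨s, b, fun i => Nat.find (hmem i), fun i => ?_, fun k => ?_⟩
  · rw [hb]
    exact (S _).2.1 (Nat.find_spec (hmem i))
  · refine (S k).2.2.1.trans (Submodule.span_mono fun x hx => ?_)
    exact ⟨⟨x, Set.mem_iUnion.mpr ⟨k, hx⟩⟩, Nat.find_min' _ hx, hb _⟩

end AdaptedBasis

theorem DFinsupp.basis_apply {ι R : Type*} {M : ι → Type*} [DecidableEq ι] [Semiring R]
    [∀ i, AddCommMonoid (M i)] [∀ i, Module R (M i)] {η : ι → Type*}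
    (b : ∀ i, Basis (η i) R (M i)) (x : Σ i, η i) :
    DFinsupp.basis b x = DFinsupp.single x.1 (b x.1 x.2) := by
  classical
  apply (DFinsupp.basis b).repr.injective
  rw [Basis.repr_self]
  ext ⟨j, y⟩
  simp only [DFinsupp.basis]
  rcases x with ⟨i, x⟩
  by_cases h : i = j
  · subst h
    simp [Finsupp.single_apply]
  · simp [h]

/-! ### The monomial basis of a symmetric algebra -/

section SymmetricAlgebraBasis

variable {R M I : Type*} [CommRing R] [AddCommGroup M] [Module R M] (b : Basis I R M)

theorem Module.Basis.symmetricAlgebra_mul (α β : I →₀ ℕ) :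
    b.symmetricAlgebra α * b.symmetricAlgebra β = b.symmetricAlgebra (α + β) := by
  simp only [Basis.symmetricAlgebra, Basis.map_apply, MvPolynomial.coe_basisMonomials,
    AlgEquiv.toLinearEquiv_apply]
  rw [← map_mul, MvPolynomial.monomial_mul, one_mul]

theorem Module.Basis.symmetricAlgebra_single (i : I) :
    b.symmetricAlgebra (Finsupp.single i 1) = SymmetricAlgebra.ι R M (b i) := by
  simp only [Basis.symmetricAlgebra, Basis.map_apply, MvPolynomial.coe_basisMonomials,
    AlgEquiv.toLinearEquiv_apply]
  exact SymmetricAlgebra.equivMvPolynomial_symm_X b i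

theorem Module.Basis.symmetricAlgebra_zero : b.symmetricAlgebra 0 = 1 := by
  simp only [Basis.symmetricAlgebra, Basis.map_apply, MvPolynomial.coe_basisMonomials,
    AlgEquiv.toLinearEquiv_apply]
  exact map_one _

end SymmetricAlgebraBasis

/-! ### The monomial basis of `ΛV` -/

noncomputable section FreeBasis

universe u

namespace RationalHomotopy

variable {V : ℕ → Type u} [∀ n, AddCommGroup (V n)] [∀ n, Module ℚ (V n)] {κ : ℕ → Type u}

/-- The index set of the even part of a homogeneous basis. -/
abbrev EvenIndex (κ : ℕ → Type u) : Type u := Σ n : {n : ℕ // Even n}, κ n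

/-- The index set of the odd part of a homogeneous basis. -/
abbrev OddIndex (κ : ℕ → Type u) : Type u := Σ n : {n : ℕ // Odd n}, κ n

/-- The basis of the even part given by a homogeneous basis. -/
def evenBasis (b : ∀ n, Basis (κ n) ℚ (V n)) : Basis (EvenIndex κ) ℚ (EvenPart V) :=
  DFinsupp.basis fun n : {n : ℕ // Even n} => b n

/-- The basis of the odd part given by a homogeneous basis. -/
def oddBasis (b : ∀ n, Basis (κ n) ℚ (V n)) : Basis (OddIndex κ) ℚ (OddPart V) :=
  DFinsupp.basis fun n : {n : ℕ // Odd n} => b n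

theorem evenBasis_apply (b : ∀ n, Basis (κ n) ℚ (V n)) (i : EvenIndex κ) :
    evenBasis b i = DirectSum.lof ℚ {n : ℕ // Even n} (fun i => V i) i.1 (b _ i.2) := by
  exact DFinsupp.basis_apply _ _

theorem oddBasis_apply (b : ∀ n, Basis (κ n) ℚ (V n)) (i : OddIndex κ) :
    oddBasis b i = DirectSum.lof ℚ {n : ℕ // Odd n} (fun i => V i) i.1 (b _ i.2) := by
  exact DFinsupp.basis_apply _ _

variable [LinearOrder (OddIndex κ)]

/-- The monomial basis of `ΛV` given by a homogeneous basis of `V`. -/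
def freeBasis (b : ∀ n, Basis (κ n) ℚ (V n)) :
    Basis ((EvenIndex κ →₀ ℕ) × Finset (OddIndex κ)) ℚ (FreeCGA V) :=
  (evenBasis b).symmetricAlgebra.tensorProduct (oddBasis b).ExteriorAlgebra

variable (b : ∀ n, Basis (κ n) ℚ (V n))

theorem freeBasis_apply (x) : freeBasis b x =
    inclSym V ((evenBasis b).symmetricAlgebra x.1) * inclExt V ((oddBasis b).ExteriorAlgebra x.2) := by
  have h : freeBasis b x =
    (evenBasis b).symmetricAlgebra x.1 ⊗ₜ[ℚ] (oddBasis b).ExteriorAlgebra x.2 :=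
    Basis.tensorProduct_apply' _ _ _
  rw [h]
  symm
  refine (Algebra.TensorProduct.tmul_mul_tmul _ _ _ _).trans ?_
  rw [mul_one, one_mul]

theorem inclSym_mul_inclExt (x y) : inclSym V x * inclExt V y = inclExt V y * inclSym V x := by
  refine (Algebra.TensorProduct.tmul_mul_tmul _ _ _ _).trans
    (Eq.trans ?_ (Algebra.TensorProduct.tmul_mul_tmul _ _ _ _).symm)
  simp only [mul_one, one_mul]

theorem freeBasis_mul_of_not_disjoint {x y} (h : ¬Disjoint x.2 y.2) :
    freeBasis b x * freeBasis b y = 0 := by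
  rw [freeBasis_apply, freeBasis_apply, mul_assoc, ← mul_assoc (inclExt V _), ← inclSym_mul_inclExt,
    mul_assoc (inclSym V _), ← map_mul (inclExt V), Basis.exteriorAlgebra_mul_of_not_disjoint _ h,
    map_zero, mul_zero, mul_zero]

/-- The sign from reordering odd factors is kept only as a nonzero scalar, which suffices for
arguments about spans. -/
theorem freeBasis_mul_of_disjoint {x y} (h : Disjoint x.2 y.2) : ∃ ε : ℚ, ε ≠ 0 ∧
    freeBasis b x * freeBasis b y = ε • freeBasis b (x.1 + y.1, x.2 ∪ y.2) := by
  obtain ⟨ε, hε⟩ := Basis.exteriorAlgebra_mul_of_disjoint (oddBasis b) h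
  refine ⟨((ε : ℤ) : ℚ), by simp, ?_⟩
  rw [freeBasis_apply, freeBasis_apply, mul_assoc, ← mul_assoc (inclExt V _), ← inclSym_mul_inclExt,
    mul_assoc (inclSym V _), ← map_mul (inclExt V), hε, freeBasis_apply, ← mul_assoc, ← map_mul,
    Basis.symmetricAlgebra_mul, Units.smul_def, map_zsmul, Int.cast_smul_eq_zsmul, mul_smul_comm]

theorem freeBasis_zero : freeBasis b (0, ∅) = 1 := by
  rw [freeBasis_apply, Basis.symmetricAlgebra_zero, Basis.exteriorAlgebra_empty, map_one, map_one,
    mul_one]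

theorem freeBasis_single (i : EvenIndex κ) :
    freeBasis b (Finsupp.single i 1, ∅) = gen i.1 (b _ i.2) := by
  rw [freeBasis_apply, Basis.symmetricAlgebra_single, Basis.exteriorAlgebra_empty, map_one, mul_one,
    evenBasis_apply, gen, dif_pos i.1.2]
  rfl

theorem freeBasis_singleton (j : OddIndex κ) :
    freeBasis b (0, {j}) = gen j.1 (b _ j.2) := by
  rw [freeBasis_apply, Basis.symmetricAlgebra_zero, Basis.exteriorAlgebra_singleton, map_one,
    one_mul, oddBasis_apply, gen, dif_neg (Nat.not_even_iff_odd.mpr j.1.2)]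
  rfl

end RationalHomotopy

end FreeBasis

/-! ### Additivity of weights and induction on exponents -/

section ExponentWeight

variable {Ie Io : Type*} [Fintype Ie] [DecidableEq Io]

theorem exponentWeight_add (f : Ie → ℕ) (g : Io → ℕ) {x y : (Ie →₀ ℕ) × Finset Io}
    (h : Disjoint x.2 y.2) :
    exponentWeight f g (x.1 + y.1, x.2 ∪ y.2) = exponentWeight f g x + exponentWeight f g y := by
  simp only [exponentWeight, Finset.sum_union h, Finsupp.add_apply, add_mul, Finset.sum_add_distrib]
  omega

omit [DecidableEq Io] in
theorem exponentLength_eq (x : (Ie →₀ ℕ) × Finset Io) :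
    exponentLength x = exponentWeight (fun _ => 1) (fun _ => 1) x := by
  simp [exponentLength, exponentWeight]

theorem exponentLength_add {x y : (Ie →₀ ℕ) × Finset Io} (h : Disjoint x.2 y.2) :
    exponentLength (x.1 + y.1, x.2 ∪ y.2) = exponentLength x + exponentLength y := by
  simp only [exponentLength_eq, exponentWeight_add _ _ h]

omit [DecidableEq Io] in
theorem exponentWeight_single (f : Ie → ℕ) (g : Io → ℕ) (i : Ie) :
    exponentWeight f g (Finsupp.single i 1, ∅) = f i := by
  classical
  simp [exponentWeight, Finsupp.single_apply]

omit [DecidableEq Io] in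
theorem exponentWeight_singleton (f : Ie → ℕ) (g : Io → ℕ) (j : Io) :
    exponentWeight f g (0, {j}) = g j := by
  simp [exponentWeight]

omit [Fintype Ie] in
theorem exponent_induction {P : (Ie →₀ ℕ) × Finset Io → Prop} (h0 : P (0, ∅))
    (h1 : ∀ i x, P x → P (Finsupp.single i 1 + x.1, ∅ ∪ x.2))
    (h2 : ∀ v x, v ∉ x.2 → P x → P (0 + x.1, {v} ∪ x.2)) (x : (Ie →₀ ℕ) × Finset Io) : P x := by
  obtain ⟨α, S⟩ := x
  have hS : P (0, S) := by
    induction S using Finset.induction_on with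
    | empty => exact h0
    | insert v S hv ih =>
      have := h2 v (0, S) hv ih
      rwa [zero_add] at this
  have hα : ∀ (n : ℕ) (i : Ie) (β : Ie →₀ ℕ), P (β, S) → P (Finsupp.single i n + β, S) := by
    intro n i β hβ
    induction n with
    | zero => simpa using hβ
    | succ n ih =>
      have := h1 i (_, S) ih
      rwa [Finset.empty_union, ← add_assoc, ← Finsupp.single_add, add_comm 1 n] at this
  induction α using Finsupp.induction with
  | zero => exact hS
  | single_add i n β _ _ ih => exact hα n i β ih

omit [DecidableEq Io] in
theorem exponentWeight_le_of_rank_le {re : Ie → ℕ} {ro : Io → ℕ} {k : ℕ}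
    {x : (Ie →₀ ℕ) × Finset Io} (he : ∀ i, x.1 i ≠ 0 → re i ≤ k) (ho : ∀ j ∈ x.2, ro j ≤ k) :
    exponentWeight (fun i => 3 ^ re i) (fun j => 3 ^ ro j) x ≤ exponentLength x * 3 ^ k := by
  rw [exponentLength, add_mul, Finset.sum_mul, Finset.card_eq_sum_ones, Finset.sum_mul]
  refine add_le_add (Finset.sum_le_sum fun i _ => ?_) (Finset.sum_le_sum fun j hj => ?_)
  · rcases eq_or_ne (x.1 i) 0 with h | h
    · simp [h]
    · exact Nat.mul_le_mul_left _ (Nat.pow_le_pow_right (by norm_num) (he i h))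
  · rw [one_mul]
    exact Nat.pow_le_pow_right (by norm_num) (ho j hj)

end ExponentWeight

/-! ### From a coformal Sullivan algebra to a quadratic model -/

namespace RationalHomotopy

universe u

variable {V : ℕ → Type u} [∀ n, AddCommGroup (V n)] [∀ n, Module ℚ (V n)] {κ : ℕ → Type u}
  [LinearOrder (OddIndex κ)] {b : ∀ n, Basis (κ n) ℚ (V n)}

theorem mul_mem_freeSpan {P Q R : (EvenIndex κ →₀ ℕ) × Finset (OddIndex κ) → Prop}
    (h : ∀ x y, Q x → R y → Disjoint x.2 y.2 → P (x.1 + y.1, x.2 ∪ y.2)) {u v : FreeCGA V}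
    (hu : u ∈ basisSpan (freeBasis b) Q) (hv : v ∈ basisSpan (freeBasis b) R) :
    u * v ∈ basisSpan (freeBasis b) P := by
  refine map_mem_of_mem_basisSpan (f := LinearMap.mulRight ℚ v) (fun x hx => ?_) hu
  refine map_mem_of_mem_basisSpan (f := LinearMap.mulLeft ℚ (freeBasis b x)) (fun y hy => ?_) hv
  rw [LinearMap.mulLeft_apply]
  by_cases hd : Disjoint x.2 y.2
  · obtain ⟨ε, _, hε⟩ := freeBasis_mul_of_disjoint b hd
    rw [hε]
    exact Submodule.smul_mem _ _ (basis_mem_basisSpan (h x y hx hy hd))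
  · rw [freeBasis_mul_of_not_disjoint b hd]
    exact zero_mem _

theorem gen_mem_freeSpan {Q : (EvenIndex κ →₀ ℕ) × Finset (OddIndex κ) → Prop} {n : ℕ}
    {C : Set (κ n)} (he : ∀ (h : Even n), ∀ j ∈ C, Q (Finsupp.single ⟨⟨n, h⟩, j⟩ 1, ∅))
    (ho : ∀ (h : Odd n), ∀ j ∈ C, Q (0, {⟨⟨n, h⟩, j⟩})) {v : V n}
    (hv : v ∈ Submodule.span ℚ (b n '' C)) : gen n v ∈ basisSpan (freeBasis b) Q := by
  have hle : Submodule.span ℚ (b n '' C) ≤ (basisSpan (freeBasis b) Q).comap (gen n) := by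
    rw [Submodule.span_le]
    rintro _ ⟨j, hj, rfl⟩
    rcases Nat.even_or_odd n with h | h
    · have := basis_mem_basisSpan (e := freeBasis b) (he h j hj)
      rw [freeBasis_single] at this
      exact this
    · have := basis_mem_basisSpan (e := freeBasis b) (ho h j hj)
      rw [freeBasis_singleton] at this
      exact this
  exact hle hv

theorem one_mem_freeSpan {Q : (EvenIndex κ →₀ ℕ) × Finset (OddIndex κ) → Prop} (h : Q (0, ∅)) :
    (1 : FreeCGA V) ∈ basisSpan (freeBasis b) Q :=
  freeBasis_zero b ▸ basis_mem_basisSpan h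

variable [Fintype (EvenIndex κ)]

theorem monomial_mem_freeSpan (f : ℕ → ℕ) (l : List (Σ n, V n)) :
    monomial l ∈ basisSpan (freeBasis b) fun x =>
      exponentWeight (fun i => f i.1) (fun j => f j.1) x = (l.map fun p => f p.1).sum := by
  induction l with
  | nil => exact one_mem_freeSpan (by simp [exponentWeight])
  | cons p l ih =>
    have hp : gen p.1 p.2 ∈ basisSpan (freeBasis b) fun x =>
        exponentWeight (fun i => f i.1) (fun j => f j.1) x = f p.1 := by
      refine gen_mem_freeSpan (C := Set.univ) ?_ ?_ ?_
      · exact fun h j _ => exponentWeight_single _ _ _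
      · exact fun h j _ => exponentWeight_singleton _ _ _
      · rw [Set.image_univ, (b p.1).span_eq]
        trivial
    have hm : monomial (p :: l) = gen p.1 p.2 * monomial l := by simp [monomial]
    rw [hm, List.map_cons, List.sum_cons]
    refine mul_mem_freeSpan (fun x y hx hy hd => ?_) hp ih
    rw [exponentWeight_add _ _ hd, hx, hy]

theorem degreePart_le_freeSpan (n : ℕ) : degreePart V n ≤ basisSpan (freeBasis b) fun x =>
    exponentWeight (fun i => (i.1 : ℕ)) (fun j => (j.1 : ℕ)) x = n := by
  refine Submodule.span_le.mpr ?_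
  rintro _ ⟨l, hl, rfl⟩
  have := monomial_mem_freeSpan (b := b) id l
  rw [← hl]
  exact this

theorem wordLengthPart_le_freeSpan (k : ℕ) : wordLengthPart V k ≤ basisSpan (freeBasis b) fun x =>
    exponentLength x = k := by
  refine Submodule.span_le.mpr ?_
  rintro _ ⟨l, hl, rfl⟩
  have := monomial_mem_freeSpan (b := b) (fun _ => 1) l
  simp only [← exponentLength_eq, List.map_const', List.sum_replicate, smul_eq_mul, mul_one, hl]
    at this
  exact this

omit [Fintype (EvenIndex κ)] in
theorem subFreeCGA_le_freeSpan {U : ∀ n, Submodule ℚ (V n)} {ρ : ∀ n, κ n → ℕ} {k : ℕ}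
    (hU : ∀ n, U n ≤ Submodule.span ℚ (b n '' {j | ρ n j ≤ k})) {u : FreeCGA V}
    (hu : u ∈ subFreeCGA U) : u ∈ basisSpan (freeBasis b) fun x =>
      (∀ i : EvenIndex κ, x.1 i ≠ 0 → ρ _ i.2 ≤ k) ∧ ∀ j ∈ x.2, ρ _ j.2 ≤ k := by
  refine Algebra.adjoin_induction ?_ ?_ ?_ ?_ hu
  · rintro _ ⟨n, v, hv, rfl⟩
    refine gen_mem_freeSpan ?_ ?_ (hU n hv)
    · refine fun h j hj => ⟨fun i hi => ?_, fun i hi => absurd hi (Finset.notMem_empty i)⟩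
      obtain rfl : ⟨⟨n, h⟩, j⟩ = i := by
        by_contra hne
        exact hi (Finsupp.single_eq_of_ne' hne)
      exact hj
    · refine fun h j hj => ⟨fun i hi => absurd rfl hi, fun i hi => ?_⟩
      obtain rfl := Finset.mem_singleton.mp hi
      exact hj
  · intro r
    rw [Algebra.algebraMap_eq_smul_one]
    exact Submodule.smul_mem _ _ (one_mem_freeSpan ⟨fun i hi => absurd rfl hi,
      fun j hj => absurd hj (Finset.notMem_empty j)⟩)
  · intro _ _ _ _ h1 h2
    exact add_mem h1 h2
  · intro _ _ _ _ h1 h2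
    refine mul_mem_freeSpan (fun x y hx hy _ => ⟨fun i hi => ?_, fun j hj => ?_⟩) h1 h2
    · rcases eq_or_ne (x.1 i) 0 with h | h
      · refine hy.1 i fun h' => hi ?_
        rw [Finsupp.add_apply, h, h']
      · exact hx.1 i h
    · exact (Finset.mem_union.mp hj).elim (hx.2 j) (hy.2 j)

end RationalHomotopy

namespace RationalHomotopy

universe u

variable {V : ℕ → Type u} [∀ n, AddCommGroup (V n)] [∀ n, Module ℚ (V n)] {κ : ℕ → Type u}
  [LinearOrder (OddIndex κ)] {b : ∀ n, Basis (κ n) ℚ (V n)} [Fintype (EvenIndex κ)]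

theorem gen_mem_degreePart {n : ℕ} (v : V n) : gen n v ∈ degreePart V n :=
  Submodule.subset_span ⟨[⟨n, v⟩], by simp, by simp [monomial]⟩

namespace MinimalSullivanAlgebra

theorem d_one (A : MinimalSullivanAlgebra V) : A.d 1 = 0 := by
  have h1 : (1 : FreeCGA V) ∈ degreePart V 0 := Submodule.subset_span ⟨[], by simp, by simp [monomial]⟩
  have := A.leibniz 0 1 1 h1
  simpa using this

omit [LinearOrder (OddIndex κ)] [Fintype (EvenIndex κ)] in
theorem pos_of_basis (A : MinimalSullivanAlgebra V) (b : ∀ n, Basis (κ n) ℚ (V n)) {n : ℕ}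
    (j : κ n) : 0 < n := by
  rcases Nat.eq_zero_or_pos n with rfl | h
  · have := A.degree_pos
    exact absurd (Subsingleton.elim _ _) ((b 0).ne_zero j)
  · exact h

/-- The exponents of the monomials in the differential of a monomial of exponent `x`. -/
def DifferentialExponent (ρ : ∀ n, κ n → ℕ) (x y : (EvenIndex κ →₀ ℕ) × Finset (OddIndex κ)) :
    Prop :=
  exponentLength y = exponentLength x + 1 ∧
    exponentWeight (fun i => (i.1 : ℕ) - 1) (fun j => (j.1 : ℕ) - 1) y =
      exponentWeight (fun i => (i.1 : ℕ) - 1) (fun j => (j.1 : ℕ) - 1) x ∧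
    exponentWeight (fun i => 3 ^ ρ _ i.2) (fun j => 3 ^ ρ _ j.2) y <
      exponentWeight (fun i => 3 ^ ρ _ i.2) (fun j => 3 ^ ρ _ j.2) x

omit [LinearOrder (OddIndex κ)] in
theorem degree_eq (A : MinimalSullivanAlgebra V) (b : ∀ n, Basis (κ n) ℚ (V n))
    (x : (EvenIndex κ →₀ ℕ) × Finset (OddIndex κ)) :
    exponentWeight (fun i => (i.1 : ℕ)) (fun j => (j.1 : ℕ)) x =
      exponentWeight (fun i => (i.1 : ℕ) - 1) (fun j => (j.1 : ℕ) - 1) x + exponentLength x := by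
  have he : ∀ i : EvenIndex κ, (i.1 : ℕ) = (i.1 : ℕ) - 1 + 1 := fun i => by
    have := A.pos_of_basis b i.2
    omega
  have ho : ∀ i : OddIndex κ, (i.1 : ℕ) = (i.1 : ℕ) - 1 + 1 := fun i => by
    have := A.pos_of_basis b i.2
    omega
  have h1 : ∑ i, x.1 i * (i.1 : ℕ) = ∑ i, x.1 i * ((i.1 : ℕ) - 1) + ∑ i, x.1 i := by
    rw [← Finset.sum_add_distrib]
    refine Finset.sum_congr rfl fun i _ => ?_
    conv_lhs => rw [he i]
    ring
  have h2 : ∑ j ∈ x.2, (j.1 : ℕ) = ∑ j ∈ x.2, ((j.1 : ℕ) - 1) + x.2.card := by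
    rw [Finset.card_eq_sum_ones, ← Finset.sum_add_distrib]
    exact Finset.sum_congr rfl fun i _ => ho i
  simp only [exponentWeight, exponentLength, h1, h2]
  omega

variable (A : MinimalSullivanAlgebra V) (hcof : A.IsCoformal) {ρ : ∀ n, κ n → ℕ}
  (hρ0 : ∀ n j, ρ n j = 0 → A.d (gen n (b n j)) = 0)
  (hρ : ∀ n j k, ρ n j = k + 1 → A.d (gen n (b n j)) ∈ basisSpan (freeBasis b) fun x =>
    (∀ i : EvenIndex κ, x.1 i ≠ 0 → ρ _ i.2 ≤ k) ∧ ∀ j ∈ x.2, ρ _ j.2 ≤ k)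

include hcof hρ0 hρ

theorem d_gen_mem (n : ℕ) (j : κ n) : A.d (gen n (b n j)) ∈ basisSpan (freeBasis b) fun y =>
    exponentLength y = 2 ∧
    exponentWeight (fun i => (i.1 : ℕ) - 1) (fun j => (j.1 : ℕ) - 1) y = n - 1 ∧
    exponentWeight (fun i => 3 ^ ρ _ i.2) (fun j => 3 ^ ρ _ j.2) y < 3 ^ ρ n j := by
  rcases hk : ρ n j with _ | k
  · rw [hρ0 n j hk]
    exact zero_mem _
  · have h1 := wordLengthPart_le_freeSpan (b := b) 2 (hcof n (b n j))
    have h2 := degreePart_le_freeSpan (b := b) (n + 1) (A.d_degree n _ (gen_mem_degreePart (b n j)))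
    refine basisSpan_mono (fun y hy => ?_) (basisSpan_and (basisSpan_and h1 h2) (hρ n j k hk))
    obtain ⟨⟨hy1, hy2⟩, hy3, hy4⟩ := hy
    have h3 := A.degree_eq b y
    have h4 := exponentWeight_le_of_rank_le (re := fun i : EvenIndex κ => ρ _ i.2)
      (ro := fun j : OddIndex κ => ρ _ j.2) hy3 hy4
    refine ⟨hy1, by omega, h4.trans_lt ?_⟩
    -- The base 3 makes two generators of smaller rank lighter than one generator: `2 * 3 ^ k < 3 ^
    -- (k + 1)`.
    rw [hy1, pow_succ, mul_comm]
    exact Nat.mul_lt_mul_of_pos_left (by norm_num) (by positivity)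

/-- Multiply in one generator at a time: by the Leibniz rule and additivity of the weights, the
three conditions pass from the factors to the product. -/
theorem d_freeBasis_mem (x) :
    A.d (freeBasis b x) ∈ basisSpan (freeBasis b) (DifferentialExponent ρ x) := by
  have hstep : ∀ (n : ℕ) (j : κ n) (x y : (EvenIndex κ →₀ ℕ) × Finset (OddIndex κ)),
      Disjoint x.2 y.2 → freeBasis b x = gen n (b n j) → exponentLength x = 1 →
      exponentWeight (fun i => (i.1 : ℕ) - 1) (fun j => (j.1 : ℕ) - 1) x = n - 1 →
      exponentWeight (fun i => 3 ^ ρ _ i.2) (fun j => 3 ^ ρ _ j.2) x = 3 ^ ρ n j →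
      A.d (freeBasis b y) ∈ basisSpan (freeBasis b) (DifferentialExponent ρ y) →
      A.d (freeBasis b (x.1 + y.1, x.2 ∪ y.2)) ∈
        basisSpan (freeBasis b) (DifferentialExponent ρ (x.1 + y.1, x.2 ∪ y.2)) := by
    intro n j x y hd hx hlen hwt hw hy
    obtain ⟨ε, hε0, hε⟩ := freeBasis_mul_of_disjoint b hd
    have h1 : freeBasis b (x.1 + y.1, x.2 ∪ y.2) = ε⁻¹ • (freeBasis b x * freeBasis b y) := by
      rw [hε, smul_smul, inv_mul_cancel₀ hε0, one_smul]
    have hgx := A.d_gen_mem hcof hρ0 hρ n j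
    rw [← hx] at hgx
    have hx' : freeBasis b x ∈ basisSpan (freeBasis b) (· = x) := basis_mem_basisSpan rfl
    have hy' : freeBasis b y ∈ basisSpan (freeBasis b) (· = y) := basis_mem_basisSpan rfl
    rw [h1, map_smul, A.leibniz n _ _ (hx ▸ gen_mem_degreePart (b n j))]
    refine Submodule.smul_mem _ _ (add_mem ?_ (Submodule.smul_mem _ _ ?_))
    · refine mul_mem_freeSpan ?_ hgx hy'
      rintro z _ ⟨hz1, hz2, hz3⟩ rfl hzd
      simp only [DifferentialExponent, exponentLength_add hzd, exponentLength_add hd,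
        exponentWeight_add _ _ hzd, exponentWeight_add _ _ hd]
      exact ⟨by omega, by omega, by omega⟩
    · refine mul_mem_freeSpan ?_ hx' hy
      rintro _ z rfl ⟨hz1, hz2, hz3⟩ hzd
      simp only [DifferentialExponent, exponentLength_add hzd, exponentLength_add hd,
        exponentWeight_add _ _ hzd, exponentWeight_add _ _ hd]
      exact ⟨by omega, by omega, by omega⟩
  refine exponent_induction (P := fun x =>
    A.d (freeBasis b x) ∈ basisSpan (freeBasis b) (DifferentialExponent ρ x)) ?_ ?_ ?_ x
  · rw [freeBasis_zero, A.d_one]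
    exact zero_mem _
  · intro i x hx
    refine hstep _ i.2 (Finsupp.single i 1, ∅) x (Finset.disjoint_empty_left _)
      (freeBasis_single b i) ?_ ?_ ?_ hx
    · rw [exponentLength_eq, exponentWeight_single]
    · rw [exponentWeight_single]
    · rw [exponentWeight_single]
  · intro v x hv hx
    refine hstep _ v.2 (0, {v}) x (Finset.disjoint_singleton_left.mpr hv)
      (freeBasis_singleton b v) ?_ ?_ ?_ hx
    · rw [exponentLength_eq, exponentWeight_singleton]
    · rw [exponentWeight_singleton]
    · rw [exponentWeight_singleton]

theorem nonempty_quadraticModel : Nonempty (QuadraticModel (freeBasis b)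
    (fun i : EvenIndex κ => (i.1 : ℕ) - 1) (fun j : OddIndex κ => (j.1 : ℕ) - 1) A.d) := by
  have hcoef : ∀ (v : OddIndex κ) x, ∃ ε : ℚ, ε ≠ 0 ∧ (v ∉ x.2 →
      freeBasis b (0, {v}) * freeBasis b x = ε • freeBasis b (x.1, insert v x.2)) := by
    intro v x
    by_cases hv : v ∈ x.2
    · exact ⟨1, one_ne_zero, fun h => absurd hv h⟩
    · obtain ⟨ε, hε0, hε⟩ := freeBasis_mul_of_disjoint b (x := (0, {v})) (y := x)
        (Finset.disjoint_singleton_left.mpr hv)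
      refine ⟨ε, hε0, fun _ => ?_⟩
      rw [hε, zero_add, Finset.insert_eq]
  choose coef hcoef0 hcoef using hcoef
  have hd := A.d_freeBasis_mem hcof hρ0 hρ
  exact ⟨{
    a_odd := fun i => Nat.Even.sub_odd (A.pos_of_basis b i.2) i.1.2 odd_one
    c_even := fun j => Nat.Odd.sub_odd j.1.2 odd_one
    d_d := A.d_d
    we := fun i => 3 ^ ρ _ i.2
    wo := fun j => 3 ^ ρ _ j.2
    d_basis := hd
    E := fun v => LinearMap.mulLeft ℚ (freeBasis b (0, {v}))
    coef := coef
    coef_ne_zero := hcoef0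
    E_of_mem := fun v x hv => freeBasis_mul_of_not_disjoint b
      (fun h => Finset.disjoint_singleton_left.mp h hv)
    E_of_notMem := fun v x hv => hcoef v x hv
    E_anticomm := by
      intro v T hv hT x hx
      have hv1 : (v.1 : ℕ) = 1 := by
        have := A.pos_of_basis b v.2
        omega
      -- As `v` has weight zero, the monomials of `d v` involve only degree-one generators, all of
      -- smaller rank and hence in `T`; so `d v` annihilates the ideal of `T`.
      have h0 : A.d (freeBasis b (0, {v})) * freeBasis b x = 0 := by
        refine map_mem_of_mem_basisSpan (N := ⊥) (f := LinearMap.mulRight ℚ (freeBasis b x))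
          (fun y hy => ?_) (hd (0, {v}))
        rw [LinearMap.mulRight_apply, Submodule.mem_bot]
        refine freeBasis_mul_of_not_disjoint b fun hdis => ?_
        obtain ⟨hy1, hy2, hy3⟩ := hy
        rw [exponentWeight_singleton] at hy2 hy3
        rw [exponentLength_eq, exponentLength_eq, exponentWeight_singleton] at hy1
        replace hy2 : ∑ i, y.1 i * ((i.1 : ℕ) - 1) + ∑ j ∈ y.2, ((j.1 : ℕ) - 1) = 0 := hy2.trans hv
        have h1 : ∀ i, y.1 i = 0 := by
          intro i
          by_contra hi
          have h2 : y.1 i * ((i.1 : ℕ) - 1) ≤ ∑ i, y.1 i * ((i.1 : ℕ) - 1) :=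
            Finset.single_le_sum (f := fun i => y.1 i * ((i.1 : ℕ) - 1))
              (fun _ _ => Nat.zero_le _) (Finset.mem_univ i)
          have h3 : 0 < (i.1 : ℕ) - 1 :=
            (Nat.Even.sub_odd (A.pos_of_basis b i.2) i.1.2 odd_one).pos
          have h4 := Nat.mul_pos (Nat.pos_of_ne_zero hi) h3
          omega
        obtain ⟨j, hj⟩ : y.2.Nonempty := by
          rw [Finset.nonempty_iff_ne_empty]
          intro he
          simp [exponentWeight, h1, he] at hy1
        have hcj : (j.1 : ℕ) - 1 = 0 := by
          have h2 : (j.1 : ℕ) - 1 ≤ ∑ j ∈ y.2, ((j.1 : ℕ) - 1) :=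
            Finset.single_le_sum (f := fun j : OddIndex κ => (j.1 : ℕ) - 1)
              (fun _ _ => Nat.zero_le _) hj
          omega
        have hwj : 3 ^ ρ _ j.2 < 3 ^ ρ _ v.2 := by
          refine lt_of_le_of_lt ?_ hy3
          have h2 : 3 ^ ρ _ j.2 ≤ ∑ j ∈ y.2, 3 ^ ρ _ j.2 :=
            Finset.single_le_sum (f := fun j : OddIndex κ => 3 ^ ρ _ j.2)
              (fun _ _ => Nat.zero_le _) hj
          exact h2.trans (Nat.le_add_left _ _)
        exact Finset.disjoint_left.mp hdis hj (hx (hT j hcj hwj))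
      have hL := A.leibniz 1 (freeBasis b (0, {v})) (freeBasis b x) (by
        rw [freeBasis_singleton, ← hv1]
        exact gen_mem_degreePart _)
      rw [h0, zero_add, pow_one, neg_smul, one_smul] at hL
      rw [LinearMap.mulLeft_apply, LinearMap.mulLeft_apply, hL, neg_neg] }⟩

end MinimalSullivanAlgebra

end RationalHomotopy

/-! ### Hilali's conjecture in the coformal case -/

open RationalHomotopy in
theorem mainTheorem2 (V : ℕ → Type*) [∀ n, AddCommGroup (V n)] [∀ n, Module ℚ (V n)]
    (A : RationalHomotopy.MinimalSullivanAlgebra V) (hell : A.IsElliptic) (hcof : A.IsCoformal) :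
    Module.finrank ℚ (DirectSum ℕ V) ≤ Module.finrank ℚ A.Cohomology := by
  obtain ⟨hV, hH⟩ := hell
  obtain ⟨F, hmono, hex, hF0, hF⟩ := A.nilpotence
  choose s b ρ hρ hspan using fun n => exists_basis_adapted (fun k => F k n)
    (fun k l hkl => hmono hkl n) (hex n)
  let B : Basis (Σ n, s n) ℚ (⨁ n, V n) := DFinsupp.basis b
  have hfin : Finite (Σ n, s n) := Module.Finite.finite_basis B
  let κ : ℕ → Type _ := fun n => s n
  have hfe : Finite (EvenIndex κ) := Finite.of_injective
    (fun i : EvenIndex κ => (⟨i.1, i.2⟩ : Σ n, s n)) (by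
      rintro ⟨⟨n, hn⟩, i⟩ ⟨⟨m, hm⟩, j⟩ h
      simp only [Sigma.mk.injEq] at h
      obtain ⟨rfl, h⟩ := h
      rw [eq_of_heq h])
  have hfo : Finite (OddIndex κ) := Finite.of_injective
    (fun i : OddIndex κ => (⟨i.1, i.2⟩ : Σ n, s n)) (by
      rintro ⟨⟨n, hn⟩, i⟩ ⟨⟨m, hm⟩, j⟩ h
      simp only [Sigma.mk.injEq] at h
      obtain ⟨rfl, h⟩ := h
      rw [eq_of_heq h])
  have := Fintype.ofFinite (Σ n, s n)
  have := Fintype.ofFinite (EvenIndex κ)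
  have := Fintype.ofFinite (OddIndex κ)
  -- Any linear order serves; it only fixes the order of factors in exterior monomials.
  let _ : LinearOrder (OddIndex κ) :=
    LinearOrder.lift' (Fintype.equivFin (OddIndex κ)) (Equiv.injective _)
  obtain ⟨M⟩ := A.nonempty_quadraticModel (κ := κ) (b := b) (ρ := ρ) hcof
    (fun n j hj => hF0 n _ (hj ▸ hρ n j))
    (fun n j k hj => subFreeCGA_le_freeSpan (fun n => hspan n k) (hF k n _ (hj ▸ hρ n j)))
  rw [Module.finrank_eq_card_basis B]
  refine le_trans ?_ M.card_le_finrank_cohomology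
  rw [← Fintype.card_sum]
  refine Fintype.card_le_of_injective (fun x => if h : Even x.1 then Sum.inl ⟨⟨x.1, h⟩, x.2⟩ else
    Sum.inr ⟨⟨x.1, Nat.not_even_iff_odd.mp h⟩, x.2⟩) ?_
  rintro ⟨n, i⟩ ⟨m, j⟩ h
  dsimp only at h
  split_ifs at h <;> simp_all
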